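/- Let $n\ge 5$ be odd, let $V:\mathbb R^n\to\mathbb R$ be measurable and suppose that for some $A$ and some $\epsilon>0$ $$|V(x)|\le A\,(1+|x|)^{-\frac{n+3}{2}-\epsilon}\qquad (x\in\mathbb R^n).$$ For $\lambda>0$ let $R_0^\pm(\lambda^2)=\lim_{\epsilon'\to0^+}(-\Delta-(\lambda^2\pm i\epsilon'))^{-1}$ be the limiting free resolvents, that is, the integral operators with kernels $R_0^\pm(\lambda^2)(x,y)=\mathcal G_n(\pm\lambda,|x-y|)$, $x\ne y$, where $$\mathcal G_n(\lambda,r)=(4\pi)^{-\frac{n-1}{2}}\,\frac{e^{i\lambda r}}{r^{n-2}}\sum_{\ell=0}^{\frac{n-3}{2}}\frac{(n-3-\ell)!}{\ell!\,\left(\frac{n-3}{2}-\ell\right)!}(-2ir\lambda)^\ell .$$ Let $\lambda_1>0$ and let $\chi:\mathbb R\to\mathbb R$ be smooth with $\chi(\lambda)=1$ for $\lambda<\lambda_1/2$ and $\chi(\lambda)=0$ for $\lambda>\lambda_1$. Let $m\ge0$ be an integer. Then for $x\neq y$ the iterated integrals defining the kernels of $R_0^\pm(VR_0^\pm)^k$,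 $k\ge 0$, converge absolutely, and there is a constant $C$ such that for all $t\ne0$ $$\sup_{x\ne y}\left|\int_0^\infty e^{it\lambda^2}\lambda\chi(\lambda)\left[\sum_{k=0}^{2m+1}(-1)^k\left\{R_0^+(VR_0^+)^k-R_0^-(VR_0^-)^k\right\}\right](\lambda^2)(x,y)\,d\lambda\right|\le C|t|^{-\frac n2},$$ where the $\lambda$-integral converges absolutely for all $x\ne y$. -/

import Mathlib

open MeasureTheory Set Filter
open scoped Nat ContDiff

/-- The radial kernel of the free limiting resolvent in odd dimension `n`,
`𝒢_n(λ, r) = C_n (e^{iλr} / r^{n-2}) ∑_{ℓ=0}^{(n-3)/2} (n-3-ℓ)! / (ℓ! ((n-3)/2-ℓ)!) (-2irλ)^ℓ`,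
with `C_n = (4π)^{-(n-1)/2}`.  This is the closed form of
`(i/4) (λ/(2πr))^{n/2-1} H^{(1)}_{n/2-1}(λr)`; for instance
`𝒢_3 = e^{iλr}/(4πr)` and `𝒢_5 = e^{iλr}(1-iλr)/(8π²r³)`. -/
noncomputable def freeGreen (n : ℕ) (lam r : ℝ) : ℂ :=
  (((4 * Real.pi) ^ ((n - 1) / 2))⁻¹ : ℝ)
    * (Complex.exp (Complex.I * lam * r) / (r : ℂ) ^ (n - 2))
    * ∑ l ∈ Finset.range ((n - 3) / 2 + 1),
        (((n - 3 - l)! : ℂ) / ((l ! : ℂ) * (((n - 3) / 2 - l)! : ℂ)))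
          * (-2 * Complex.I * r * lam) ^ l

/-- The integral kernel of the free limiting resolvent: for `lam > 0`,
`R₀⁺(lam²)(x,y) = freeResolvent lam x y` and `R₀⁻(lam²)(x,y) = freeResolvent (-lam) x y`
(off the diagonal, on which the kernel is singular). -/
noncomputable def freeResolvent {n : ℕ} (lam : ℝ) (x y : EuclideanSpace ℝ (Fin n)) : ℂ :=
  freeGreen n lam ‖x - y‖

/-- The integrand of the kernel of the composition `K ∘ V ∘ L`, where `K`, `L` are integral
operators given by their kernels and `V` acts by multiplication. -/
noncomputable def compIntegrand {n : ℕ} (V : EuclideanSpace ℝ (Fin n) → ℝ)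
    (K L : EuclideanSpace ℝ (Fin n) → EuclideanSpace ℝ (Fin n) → ℂ)
    (x y z : EuclideanSpace ℝ (Fin n)) : ℂ :=
  K x z * (V z : ℂ) * L z y

/-- The integral kernel of the `k`-th Born term (without its sign) `R₀ (V R₀)^k`, with
`R₀ = R₀⁺(lam²)`; replacing `lam` by `-lam` gives the term with `R₀⁻(lam²)`. -/
noncomputable def bornKernel {n : ℕ} (V : EuclideanSpace ℝ (Fin n) → ℝ) (lam : ℝ) :
    ℕ → EuclideanSpace ℝ (Fin n) → EuclideanSpace ℝ (Fin n) → ℂ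
  | 0 => freeResolvent lam
  | k + 1 => fun x y =>
      ∫ z, compIntegrand V (bornKernel V lam k) (freeResolvent lam) x y z

/-- The kernel of `∑_{k=0}^{2m+1} (-1)^k {R₀⁺(VR₀⁺)^k - R₀⁻(VR₀⁻)^k}(lam²)`. -/
noncomputable def bornDifference {n : ℕ} (V : EuclideanSpace ℝ (Fin n) → ℝ) (m : ℕ) (lam : ℝ)
    (x y : EuclideanSpace ℝ (Fin n)) : ℂ :=
  ∑ k ∈ Finset.range (2 * m + 2),
    (-1 : ℂ) ^ k * (bornKernel V lam k x y - bornKernel V (-lam) k x y)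

/-- The integrand `e^{itλ²} λ χ(λ) [∑_k …](λ²)(x,y)` of the low-energy oscillatory integral. -/
noncomputable def stoneIntegrand {n : ℕ} (V : EuclideanSpace ℝ (Fin n) → ℝ) (χ : ℝ → ℝ) (m : ℕ)
    (t : ℝ) (x y : EuclideanSpace ℝ (Fin n)) (lam : ℝ) : ℂ :=
  Complex.exp (Complex.I * t * (lam : ℂ) ^ 2) * (lam : ℂ) * (χ lam : ℂ)
    * bornDifference V m lam x y

/-- A smooth low-energy cut-off: `χ = 1` on `λ < lam1/2` and `χ = 0` on `λ > lam1`. -/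
structure IsLowEnergyCutoff (χ : ℝ → ℝ) (lam1 : ℝ) : Prop where
  smooth : ContDiff ℝ ∞ χ
  eq_one : ∀ s, s < lam1 / 2 → χ s = 1
  eq_zero : ∀ s, lam1 < s → χ s = 0

/-!
In dimension `n = 2M + 3` the kernel `R₀^±(VR₀^±)^k(x, y)` integrates, over the intermediate points
of a path from `x` to `y`, the potentials times a product of `k + 1` radial kernels `𝒢_n(±λ, r_i)`.
The `λ`-integral is estimated for fixed step lengths `r_i`, and the intermediate points are
integrated out afterwards.

*Fixed step lengths.* Telescoping `∏ 𝒢_n(λ, r_i) - ∏ 𝒢_n(-λ, r_i)` leaves in each term one difference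
`𝒢_n(λ, r) - 𝒢_n(-λ, r)`, which by Poisson's integral (`exists_freeGreen_sub_eq`) equals
`κ λ^{2M+1} E(λr)` with `E(u) = ∫_{-1}^1 e^{ius} (1 - s²)^M ds`. Together with the factor `λ` of the
spectral measure, the amplitude carries `λ^{2(M+1)}`, enough for `M + 1` integrations by parts
against `e^{itλ²}`; Van der Corput's bound supplies the remaining `|t|^{-1/2}`. A derivative that
falls on `E(λr)` is harmless, since `u E'(u)` is a Poisson integral of the same kind with one order
of vanishing less at `s = ±1`. A derivative that falls on the phase `e^{iσλ}` of the other factors,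
`|σ| ≤ ∑ r_i`, produces a growing factor `σ`, but one more integration by parts in `s` turns it into
`σ / r`. The order of vanishing `M` of the weight `(1 - s²)^M` is just sufficient. This mechanism is
`IsProfile`, with `IsProfile.exists_bound` and `isProfile_poissonProfile`. The result
(`exists_greenProd_sub_bound`) is `C |t|^{-n/2}` times the sum, over the steps of the path, of the
product of `K(r_i) = r_i^{-(n-2)} + r_i^{-(n-1)/2}` over all other steps.

*Integrating out the intermediate points.* The operator with kernel `|V(z)| K(|z - y|)` is bounded
uniformly in `y` (`exists_potential_bound`), and `K` has the quasi-metric property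
`K(a) K(b) ≲ K(c) (K(a) + K(b))` for `c ≤ a + b` (`greenMajorant_mul_le`). Consequently a path whose
steps all carry a factor `K` contributes at most a multiple of `K(|x - y|)`, and a path with one
factor omitted a bounded amount (`exists_born_integral_bound`).
-/

/-! ### Fresnel integrals -/

lemma norm_cexp_I_mul_mul_sq (t s : ℝ) : ‖Complex.exp (Complex.I * t * (s : ℂ) ^ 2)‖ = 1 := by
  rw [show Complex.I * t * (s : ℂ) ^ 2 = ((t * s ^ 2 : ℝ) : ℂ) * Complex.I by push_cast; ring]
  exact Complex.norm_exp_ofReal_mul_I _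

lemma norm_cexp_I_mul_mul (σ s : ℝ) : ‖Complex.exp (Complex.I * σ * s)‖ = 1 := by
  rw [show Complex.I * σ * (s : ℂ) = ((σ * s : ℝ) : ℂ) * Complex.I by push_cast; ring]
  exact Complex.norm_exp_ofReal_mul_I _

lemma hasDerivAt_cexp_I_mul_mul_sq (t s : ℝ) :
    HasDerivAt (fun x : ℝ => Complex.exp (Complex.I * t * (x : ℂ) ^ 2))
      (Complex.exp (Complex.I * t * (s : ℂ) ^ 2) * (2 * Complex.I * t * s)) s := by
  have h1 : HasDerivAt (fun x : ℝ => (x : ℂ)) 1 s := Complex.ofRealCLM.hasDerivAt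
  have h2 := ((h1.pow 2).const_mul (Complex.I * t)).cexp
  refine h2.congr_deriv ?_
  simp only [Pi.pow_apply]
  push_cast
  ring

lemma hasDerivAt_cexp_I_mul_mul (σ s : ℝ) :
    HasDerivAt (fun x : ℝ => Complex.exp (Complex.I * σ * x))
      (Complex.exp (Complex.I * σ * s) * (Complex.I * σ)) s := by
  have h1 : HasDerivAt (fun x : ℝ => (x : ℂ)) 1 s := Complex.ofRealCLM.hasDerivAt
  have h2 := (h1.const_mul (Complex.I * σ)).cexp
  convert h2 using 1
  simp

lemma rpow_neg_half_sq {t : ℝ} (ht : t ≠ 0) :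
    |t| ^ (-(1 / 2) : ℝ) * |t| ^ (-(1 / 2) : ℝ) = |t|⁻¹ := by
  rw [← Real.rpow_add (abs_pos.2 ht), ← Real.rpow_neg_one]
  norm_num

/-- Away from the stationary point the phase is integrated by parts once. -/
lemma norm_integral_fresnel_tail {t : ℝ} (ht : t ≠ 0) {δ x : ℝ} (hδ : 0 < δ) (hx : δ ≤ x) :
    ‖∫ s in δ..x, Complex.exp (Complex.I * t * (s : ℂ) ^ 2)‖ ≤ |t|⁻¹ * δ⁻¹ := by
  have hpos : ∀ s ∈ Set.uIcc δ x, 0 < s := fun s hs => by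
    rw [Set.uIcc_of_le hx] at hs; exact hδ.trans_le hs.1
  have htC : (t : ℂ) ≠ 0 := by exact_mod_cast ht
  set E : ℝ → ℂ := fun s => Complex.exp (Complex.I * t * (s : ℂ) ^ 2) with hE
  have hEc : Continuous E := by fun_prop
  set c : ℂ := (2 * Complex.I * t)⁻¹ with hc
  have hcn : ‖c‖ = (2 * |t|)⁻¹ := by simp [hc]
  have hcmul : c * (2 * Complex.I * t) = 1 := by
    rw [hc]; field_simp
  have hder : ∀ s ∈ Set.uIcc δ x, HasDerivAt (fun s : ℝ => c * (E s * (s : ℂ)⁻¹))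
      (E s - c * (E s * ((s : ℂ) ^ 2)⁻¹)) s := by
    intro s hs
    have hs0 : (s : ℂ) ≠ 0 := by exact_mod_cast (hpos s hs).ne'
    have h1 : HasDerivAt (fun x : ℝ => (x : ℂ)) 1 s := Complex.ofRealCLM.hasDerivAt
    have h2 := ((hasDerivAt_cexp_I_mul_mul_sq t s).mul (h1.inv hs0)).const_mul c
    refine h2.congr_deriv ?_
    simp only [Pi.inv_apply]
    have : c * (E s * (2 * Complex.I * t * s) * (s : ℂ)⁻¹) = E s := by
      rw [show c * (E s * (2 * Complex.I * t * s) * (s : ℂ)⁻¹)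
        = (c * (2 * Complex.I * t)) * E s * (s * (s : ℂ)⁻¹) by ring, hcmul, mul_inv_cancel₀ hs0]
      ring
    change c * (E s * (2 * Complex.I * t * s) * (s : ℂ)⁻¹ + E s * (-1 / (s : ℂ) ^ 2)) = _
    rw [mul_add, this]; ring
  have hci : ContinuousOn (fun s : ℝ => c * (E s * ((s : ℂ) ^ 2)⁻¹)) (Set.uIcc δ x) := by
    refine continuousOn_const.mul (hEc.continuousOn.mul (ContinuousOn.inv₀ (by fun_prop) ?_))
    intro s hs
    have : (s : ℂ) ≠ 0 := by exact_mod_cast (hpos s hs).ne'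
    exact pow_ne_zero 2 this
  have hftc := intervalIntegral.integral_eq_sub_of_hasDerivAt hder
    ((hEc.continuousOn.sub hci).intervalIntegrable)
  rw [intervalIntegral.integral_sub (hEc.intervalIntegrable _ _) hci.intervalIntegrable] at hftc
  have hrem : ‖∫ s in δ..x, c * (E s * ((s : ℂ) ^ 2)⁻¹)‖ ≤ (2 * |t|)⁻¹ * (δ⁻¹ - x⁻¹) := by
    have hd : ∀ s ∈ Set.uIcc δ x, HasDerivAt (fun s : ℝ => -((2 * |t|)⁻¹ * s⁻¹))
        ((2 * |t|)⁻¹ * (s ^ 2)⁻¹) s := by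
      intro s hs
      refine (((hasDerivAt_inv (hpos s hs).ne').const_mul (2 * |t|)⁻¹).neg).congr_deriv ?_
      ring
    have hgi : IntervalIntegrable (fun s : ℝ => (2 * |t|)⁻¹ * (s ^ 2)⁻¹) volume δ x := by
      refine ContinuousOn.intervalIntegrable (continuousOn_const.mul
        (ContinuousOn.inv₀ (by fun_prop) ?_))
      intro s hs
      have := (hpos s hs).ne'
      positivity
    have hv := intervalIntegral.integral_eq_sub_of_hasDerivAt hd hgi
    calc _ ≤ ∫ s in δ..x, (2 * |t|)⁻¹ * (s ^ 2)⁻¹ := by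
            refine intervalIntegral.norm_integral_le_of_norm_le hx (ae_of_all _ fun s _ => ?_) hgi
            rw [norm_mul, norm_mul, hcn, norm_cexp_I_mul_mul_sq]
            simp
      _ = _ := by rw [hv]; ring
  have hb : ∀ s : ℝ, 0 < s → ‖c * (E s * (s : ℂ)⁻¹)‖ = (2 * |t|)⁻¹ * s⁻¹ := by
    intro s hs
    rw [norm_mul, norm_mul, hcn, norm_cexp_I_mul_mul_sq]
    simp [abs_of_pos hs]
  have heq : (∫ s in δ..x, E s) = c * (E x * (x : ℂ)⁻¹) - c * (E δ * (δ : ℂ)⁻¹)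
      + ∫ s in δ..x, c * (E s * ((s : ℂ) ^ 2)⁻¹) := by
    rw [← hftc]; ring
  rw [heq]
  calc _ ≤ ‖c * (E x * (x : ℂ)⁻¹)‖ + ‖c * (E δ * (δ : ℂ)⁻¹)‖
        + ‖∫ s in δ..x, c * (E s * ((s : ℂ) ^ 2)⁻¹)‖ :=
        (norm_add_le _ _).trans (add_le_add_left (norm_sub_le _ _) _)
    _ ≤ (2 * |t|)⁻¹ * x⁻¹ + (2 * |t|)⁻¹ * δ⁻¹ + (2 * |t|)⁻¹ * (δ⁻¹ - x⁻¹) := by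
        rw [hb x (hδ.trans_le hx), hb δ hδ]; gcongr
    _ = |t|⁻¹ * δ⁻¹ := by rw [mul_inv]; ring

lemma norm_integral_fresnel_zero {t : ℝ} (ht : t ≠ 0) {x : ℝ} (hx : 0 ≤ x) :
    ‖∫ s in (0 : ℝ)..x, Complex.exp (Complex.I * t * (s : ℂ) ^ 2)‖
      ≤ 2 * |t| ^ (-(1 / 2) : ℝ) := by
  set δ := |t| ^ (-(1 / 2) : ℝ) with hδdef
  have hδ : 0 < δ := Real.rpow_pos_of_pos (abs_pos.2 ht) _
  have htriv : ∀ y : ℝ, 0 ≤ y →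
      ‖∫ s in (0 : ℝ)..y, Complex.exp (Complex.I * t * (s : ℂ) ^ 2)‖ ≤ y := by
    intro y hy
    have := intervalIntegral.norm_integral_le_of_norm_le_const (a := 0) (b := y) (C := 1)
      (f := fun s : ℝ => Complex.exp (Complex.I * t * (s : ℂ) ^ 2))
      (fun s _ => (norm_cexp_I_mul_mul_sq t s).le)
    simpa [abs_of_nonneg hy] using this
  rcases le_total x δ with h | h
  · linarith [htriv x hx]
  · have hc : Continuous fun s : ℝ => Complex.exp (Complex.I * t * (s : ℂ) ^ 2) := by fun_prop
    rw [← intervalIntegral.integral_add_adjacent_intervals (hc.intervalIntegrable 0 δ)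
      (hc.intervalIntegrable δ x)]
    have h1 := norm_integral_fresnel_tail ht hδ h
    have h2 : |t|⁻¹ * δ⁻¹ = δ := by
      rw [← rpow_neg_half_sq ht, ← hδdef]; field_simp
    have h3 := htriv δ hδ.le
    exact (norm_add_le _ _).trans (by linarith)

/-- Uniform bound for the incomplete Fresnel integrals. -/
lemma norm_integral_fresnel {t : ℝ} (ht : t ≠ 0) (a b : ℝ) :
    ‖∫ s in a..b, Complex.exp (Complex.I * t * (s : ℂ) ^ 2)‖
      ≤ 4 * |t| ^ (-(1 / 2) : ℝ) := by
  have hc : Continuous fun s : ℝ => Complex.exp (Complex.I * t * (s : ℂ) ^ 2) := by fun_prop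
  have h0 : ∀ x : ℝ, ‖∫ s in (0 : ℝ)..x, Complex.exp (Complex.I * t * (s : ℂ) ^ 2)‖
      ≤ 2 * |t| ^ (-(1 / 2) : ℝ) := by
    intro x
    rcases le_total 0 x with hx | hx
    · exact norm_integral_fresnel_zero ht hx
    · have := norm_integral_fresnel_zero ht (neg_nonneg.2 hx)
      have h2 := intervalIntegral.integral_comp_neg (a := 0) (b := -x)
        (fun s : ℝ => Complex.exp (Complex.I * t * (s : ℂ) ^ 2))
      simp only [Complex.ofReal_neg, even_two, Even.neg_pow, neg_neg, neg_zero] at h2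
      rw [intervalIntegral.integral_symm, norm_neg, ← h2]
      exact this
  have h := intervalIntegral.integral_interval_sub_left (hc.intervalIntegrable 0 b)
    (hc.intervalIntegrable (μ := volume) 0 a)
  rw [← h]
  exact (norm_sub_le _ _).trans (by linarith [h0 a, h0 b])

/-- Completing the square removes the linear part of the phase. -/
lemma norm_integral_quadratic_phase {t : ℝ} (ht : t ≠ 0) (σ a b : ℝ) :
    ‖∫ s in a..b, Complex.exp (Complex.I * t * (s : ℂ) ^ 2) * Complex.exp (Complex.I * σ * s)‖
      ≤ 4 * |t| ^ (-(1 / 2) : ℝ) := by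
  have htC : (t : ℂ) ≠ 0 := by exact_mod_cast ht
  have h : ∀ s : ℝ, Complex.exp (Complex.I * t * (s : ℂ) ^ 2) * Complex.exp (Complex.I * σ * s)
      = Complex.exp (Complex.I * (-(σ ^ 2 / (4 * t)) : ℝ) * (1 : ℝ)) *
        Complex.exp (Complex.I * t * ((s + σ / (2 * t) : ℝ) : ℂ) ^ 2) := by
    intro s
    rw [← Complex.exp_add, ← Complex.exp_add]
    congr 1
    push_cast
    field_simp
    ring
  simp_rw [h]
  rw [intervalIntegral.integral_const_mul, norm_mul, norm_cexp_I_mul_mul, one_mul,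
    intervalIntegral.integral_comp_add_right
      (fun s : ℝ => Complex.exp (Complex.I * t * (s : ℂ) ^ 2))]
  exact norm_integral_fresnel ht _ _

/-! ### Van der Corput's bound for smooth amplitudes -/

/-- Smooth amplitudes on `[0, L]` which vanish beyond `L`; nothing is required at `0`. -/
structure IsAmplitude (L : ℝ) (η : ℝ → ℂ) : Prop where
  smooth : ContDiff ℝ ∞ η
  eq_zero : ∀ s, L < s → η s = 0

namespace IsAmplitude

variable {L : ℝ} {η θ : ℝ → ℂ}

lemma continuous (h : IsAmplitude L η) : Continuous η := h.smooth.continuous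

lemma hasDerivAt (h : IsAmplitude L η) (s : ℝ) : HasDerivAt η (deriv η s) s :=
  (h.smooth.differentiable (by simp) s).hasDerivAt

lemma apply_right (h : IsAmplitude L η) : η L = 0 := by
  have h1 : Tendsto η (nhdsWithin L (Ioi L)) (nhds (η L)) :=
    h.continuous.continuousAt.tendsto.mono_left nhdsWithin_le_nhds
  have h2 : Tendsto η (nhdsWithin L (Ioi L)) (nhds 0) :=
    tendsto_const_nhds.congr' (by
      filter_upwards [self_mem_nhdsWithin] with s hs using (h.eq_zero s hs).symm)
  exact tendsto_nhds_unique h1 h2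

protected lemma deriv (h : IsAmplitude L η) : IsAmplitude L (deriv η) where
  smooth := (contDiff_infty_iff_deriv.1 h.smooth).2
  eq_zero s hs := by
    have : η =ᶠ[nhds s] fun _ => 0 := by
      filter_upwards [Ioi_mem_nhds hs] with x hx using h.eq_zero x hx
    rw [this.deriv_eq]; simp

protected lemma add (h : IsAmplitude L η) (h' : IsAmplitude L θ) :
    IsAmplitude L (fun s => η s + θ s) where
  smooth := h.smooth.add h'.smooth
  eq_zero s hs := by simp [h.eq_zero s hs, h'.eq_zero s hs]

protected lemma smooth_mul (h : IsAmplitude L η) (hθ : ContDiff ℝ ∞ θ) :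
    IsAmplitude L (fun s => θ s * η s) where
  smooth := hθ.mul h.smooth
  eq_zero s hs := by simp [h.eq_zero s hs]

lemma id_mul (h : IsAmplitude L η) : IsAmplitude L (fun s => (s : ℂ) * η s) :=
  h.smooth_mul Complex.ofRealCLM.contDiff

lemma const_mul (h : IsAmplitude L η) (c : ℂ) : IsAmplitude L (fun s => c * η s) :=
  h.smooth_mul contDiff_const

lemma pow_mul (h : IsAmplitude L η) (k : ℕ) : IsAmplitude L (fun s => (s : ℂ) ^ k * η s) :=
  h.smooth_mul (Complex.ofRealCLM.contDiff.pow k)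

end IsAmplitude

/-- The integral `∫₀^L e^{itλ²} g(λ) dλ`. -/
noncomputable def schrodingerIntegral (L t : ℝ) (g : ℝ → ℂ) : ℂ :=
  ∫ s in (0 : ℝ)..L, Complex.exp (Complex.I * t * (s : ℂ) ^ 2) * g s

section
variable {L t : ℝ} {f g : ℝ → ℂ}

lemma schrodingerIntegral_add (hf : Continuous f) (hg : Continuous g) :
    schrodingerIntegral L t (fun s => f s + g s)
      = schrodingerIntegral L t f + schrodingerIntegral L t g := by
  unfold schrodingerIntegral
  rw [← intervalIntegral.integral_add]
  · simp_rw [mul_add]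
  · exact Continuous.intervalIntegrable (by fun_prop) _ _
  · exact Continuous.intervalIntegrable (by fun_prop) _ _

lemma schrodingerIntegral_const_mul (c : ℂ) :
    schrodingerIntegral L t (fun s => c * g s) = c * schrodingerIntegral L t g := by
  unfold schrodingerIntegral
  rw [← intervalIntegral.integral_const_mul]
  congr 1; ext s; ring

lemma schrodingerIntegral_sum {ι : Type*} (S : Finset ι) (G : ι → ℝ → ℂ)
    (hG : ∀ i ∈ S, Continuous (G i)) :
    schrodingerIntegral L t (fun s => ∑ i ∈ S, G i s) = ∑ i ∈ S, schrodingerIntegral L t (G i) := by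
  unfold schrodingerIntegral
  rw [← intervalIntegral.integral_finsetSum]
  · simp_rw [Finset.mul_sum]
  · intro i hi
    have := hG i hi
    exact Continuous.intervalIntegrable (by fun_prop) _ _
end

/-- Van der Corput's bound, uniform in the linear part of the phase. -/
lemma exists_schrodingerIntegral_le {L : ℝ} (hL : 0 < L) {η : ℝ → ℂ} (hη : IsAmplitude L η) :
    ∃ C : ℝ, ∀ t : ℝ, t ≠ 0 → ∀ σ : ℝ,
      ‖schrodingerIntegral L t (fun s => η s * Complex.exp (Complex.I * σ * s))‖
        ≤ C * |t| ^ (-(1 / 2) : ℝ) := by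
  have hdc := hη.deriv.continuous
  refine ⟨4 * ∫ s in (0 : ℝ)..L, ‖deriv η s‖, fun t ht σ => ?_⟩
  set e : ℝ → ℂ := fun s =>
    Complex.exp (Complex.I * t * (s : ℂ) ^ 2) * Complex.exp (Complex.I * σ * s) with he
  have hec : Continuous e := by fun_prop
  set Ψ : ℝ → ℂ := fun x => ∫ s in (0 : ℝ)..x, e s with hΨ
  have hΨd : ∀ x, HasDerivAt Ψ (e x) x := fun x =>
    intervalIntegral.integral_hasDerivAt_right (hec.intervalIntegrable _ _)
      hec.stronglyMeasurable.stronglyMeasurableAtFilter hec.continuousAt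
  have hΨc : Continuous Ψ := continuous_iff_continuousAt.2 fun x => (hΨd x).continuousAt
  have hparts := intervalIntegral.integral_mul_deriv_eq_deriv_mul (a := 0) (b := L)
    (fun x _ => hη.hasDerivAt x) (fun x _ => hΨd x) (hdc.intervalIntegrable _ _)
    (hec.intervalIntegrable _ _)
  have hΨ0 : Ψ 0 = 0 := by simp [hΨ]
  rw [hη.apply_right, hΨ0, zero_mul, mul_zero, sub_zero, zero_sub] at hparts
  have : schrodingerIntegral L t (fun s => η s * Complex.exp (Complex.I * σ * s))
      = ∫ s in (0 : ℝ)..L, η s * e s := by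
    unfold schrodingerIntegral
    congr 1; ext s; simp only [he]; ring
  rw [this, hparts, norm_neg]
  calc _ ≤ ∫ s in (0 : ℝ)..L, ‖deriv η s‖ * (4 * |t| ^ (-(1 / 2) : ℝ)) := by
        refine intervalIntegral.norm_integral_le_of_norm_le hL.le (ae_of_all _ fun s _ => ?_)
          (Continuous.intervalIntegrable (by fun_prop) _ _)
        rw [norm_mul]
        gcongr
        exact norm_integral_quadratic_phase ht σ 0 s
    _ = _ := by rw [intervalIntegral.integral_mul_const]; ring

/-! ### Profiles and repeated integration by parts -/

/-- Profiles `F` for which `F(λr)`, used as an amplitude with a factor `λ^{2h}`, allows `h`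
integrations by parts against `e^{itλ²}`.  At order `0` the oscillatory integral obeys Van der
Corput's bound uniformly in `r`; one more order asks that `u F'(u)` and `u F(u)` are of the
previous order. The second requirement encodes the decay of `F`: it allows growth in another
phase to be paid for by negative powers of `r`. -/
def IsProfile (L : ℝ) : ℕ → (ℝ → ℂ) → Prop
  | 0, F => Continuous F ∧ ∀ η, IsAmplitude L η → ∃ C : ℝ, ∀ t : ℝ, t ≠ 0 → ∀ σ r : ℝ, 0 < r →
      ‖schrodingerIntegral L t
        (fun s => η s * Complex.exp (Complex.I * σ * s) * F (s * r))‖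
        ≤ C * |t| ^ (-(1 / 2) : ℝ)
  | h + 1, F => IsProfile L h F ∧ ∃ F' : ℝ → ℂ, (∀ u, HasDerivAt F (F' u) u) ∧ Continuous F' ∧
      IsProfile L h (fun u => u * F' u) ∧ IsProfile L h (fun u => u * F u)

lemma IsProfile.continuous {L : ℝ} : ∀ {h : ℕ} {F : ℝ → ℂ}, IsProfile L h F → Continuous F
  | 0, _, hF => hF.1
  | _ + 1, _, hF => hF.1.continuous

/-- One integration by parts against `e^{itλ²}`. -/
lemma schrodingerIntegral_id_mul {L t : ℝ} (ht : t ≠ 0) {G G' : ℝ → ℂ}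
    (hG : ∀ s, HasDerivAt G (G' s) s) (hG' : Continuous G') (h0 : G 0 = 0) (hL : G L = 0) :
    schrodingerIntegral L t (fun s => s * G s)
      = -(2 * Complex.I * t)⁻¹ * schrodingerIntegral L t G' := by
  have htC : (t : ℂ) ≠ 0 := by exact_mod_cast ht
  have hparts := intervalIntegral.integral_mul_deriv_eq_deriv_mul (a := 0) (b := L)
    (fun x _ => hG x) (fun x _ => hasDerivAt_cexp_I_mul_mul_sq t x)
    (hG'.intervalIntegrable _ _) (Continuous.intervalIntegrable (by fun_prop) _ _)
  rw [h0, hL, zero_mul, zero_mul, sub_zero, zero_sub] at hparts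
  have h1 : (2 * Complex.I * t) * schrodingerIntegral L t (fun s => s * G s)
      = - schrodingerIntegral L t G' := by
    rw [← schrodingerIntegral_const_mul]
    unfold schrodingerIntegral
    calc _ = ∫ s in (0 : ℝ)..L,
          G s * (Complex.exp (Complex.I * t * (s : ℂ) ^ 2) * (2 * Complex.I * t * s)) := by
            congr 1; ext s; ring
      _ = _ := by
            rw [hparts]
            congr 2; ext s; ring
  have h2 : (2 * Complex.I * t) ≠ 0 := by simp [htC]
  rw [neg_mul, ← mul_neg, ← h1, inv_mul_cancel_left₀ h2]

/-- Repeated integration by parts: a profile of order `h` gains `|t|^{-h}`, and every derivative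
that falls on the phase `e^{iσλ}` costs only `|σ| / max 1 r`. -/
lemma IsProfile.exists_bound {L : ℝ} : ∀ {h : ℕ} {F : ℝ → ℂ}, IsProfile L h F →
    ∀ {η : ℝ → ℂ}, IsAmplitude L η → ∃ C : ℝ, ∀ t : ℝ, t ≠ 0 → ∀ σ r : ℝ, 0 < r →
      ‖schrodingerIntegral L t (fun s => (s : ℂ) ^ (2 * h) *
        (η s * Complex.exp (Complex.I * σ * s) * F (s * r)))‖
        ≤ C * (|t| ^ (-(1 / 2) : ℝ) * |t|⁻¹ ^ h * (1 + |σ| / max 1 r) ^ h)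
  | 0, F, hF, η, hη => by simpa using hF.2 η hη
  | h + 1, F, ⟨hF, F', hder, hF'c, hF', huF⟩, η, hη => by
    have hFc := hF.continuous
    have hηc := hη.continuous
    have hdηc := hη.deriv.continuous
    obtain ⟨C₁, hC₁⟩ := hF.exists_bound
      ((hη.const_mul ((2 * h + 1 : ℕ) : ℂ)).add hη.deriv.id_mul)
    obtain ⟨C₂, hC₂⟩ := hF.exists_bound hη.id_mul
    obtain ⟨C₃, hC₃⟩ := hF'.exists_bound hη
    obtain ⟨C₄, hC₄⟩ := huF.exists_bound hη
    refine ⟨|C₁| + |C₂| + |C₃| + |C₄|, fun t ht σ r hr => ?_⟩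
    set a := |σ| / max 1 r with ha
    have hmax : (1 : ℝ) ≤ max 1 r := le_max_left _ _
    have ha0 : 0 ≤ a := by positivity
    set B := |t| ^ (-(1 / 2) : ℝ) * |t|⁻¹ ^ h * (1 + a) ^ h with hB
    have hB0 : 0 ≤ B := by positivity
    set g₁ : ℝ → ℂ := fun s => (s : ℂ) ^ (2 * h) *
      ((((2 * h + 1 : ℕ) : ℂ) * η s + s * deriv η s) * Complex.exp (Complex.I * σ * s)
        * F (s * r)) with hg₁
    set g₂ : ℝ → ℂ := fun s => (s : ℂ) ^ (2 * h) *
      ((s * η s) * Complex.exp (Complex.I * σ * s) * F (s * r)) with hg₂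
    set g₃ : ℝ → ℂ := fun s => (s : ℂ) ^ (2 * h) *
      (η s * Complex.exp (Complex.I * σ * s) * (((s * r : ℝ) : ℂ) * F' (s * r))) with hg₃
    set g₄ : ℝ → ℂ := fun s => (s : ℂ) ^ (2 * h) *
      (η s * Complex.exp (Complex.I * σ * s) * (((s * r : ℝ) : ℂ) * F (s * r))) with hg₄
    have hg₁c : Continuous g₁ := by fun_prop
    have hg₂c : Continuous g₂ := by fun_prop
    have hg₃c : Continuous g₃ := by fun_prop
    have b₁ : ‖schrodingerIntegral L t g₁‖ ≤ |C₁| * B :=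
      (hC₁ t ht σ r hr).trans (by gcongr; exact le_abs_self _)
    have b₃ : ‖schrodingerIntegral L t g₃‖ ≤ |C₃| * B :=
      (hC₃ t ht σ r hr).trans (by gcongr; exact le_abs_self _)
    -- the derivative of the phase: bounded `r` is absorbed in the amplitude, large `r` is
    -- traded for a factor `u` on the profile
    have b₂ : ‖Complex.I * σ * schrodingerIntegral L t g₂‖ ≤ a * ((|C₂| + |C₄|) * B) := by
      rcases le_total r 1 with h1 | h1
      · have haσ : a = |σ| := by rw [ha, max_eq_left h1, div_one]
        have := (hC₂ t ht σ r hr).trans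
          (mul_le_mul_of_nonneg_right (le_abs_self C₂) hB0)
        rw [norm_mul, norm_mul, Complex.norm_I, one_mul, Complex.norm_real, Real.norm_eq_abs,
          haσ]
        refine mul_le_mul_of_nonneg_left (this.trans ?_) (abs_nonneg _)
        nlinarith [abs_nonneg C₄]
      · have hrC : (r : ℂ) ≠ 0 := by exact_mod_cast hr.ne'
        have haσ : a = |σ| / r := by rw [ha, max_eq_right h1]
        have h24 : g₂ = fun s => (r : ℂ)⁻¹ * g₄ s := by
          ext s; simp only [hg₂, hg₄]; push_cast; field_simp
        have := (hC₄ t ht σ r hr).trans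
          (mul_le_mul_of_nonneg_right (le_abs_self C₄) hB0)
        rw [h24, schrodingerIntegral_const_mul, norm_mul, norm_mul, norm_mul, Complex.norm_I,
          one_mul, norm_inv, Complex.norm_real, Complex.norm_real, Real.norm_eq_abs,
          Real.norm_eq_abs, abs_of_pos hr, haσ, ← mul_assoc, ← div_eq_mul_inv]
        refine mul_le_mul_of_nonneg_left (this.trans ?_) (by positivity)
        nlinarith [abs_nonneg C₂]
    set G : ℝ → ℂ := fun s => (s : ℂ) ^ (2 * h + 1) *
        (η s * Complex.exp (Complex.I * σ * s) * F (s * r)) with hG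
    have hGd : ∀ s, HasDerivAt G (g₁ s + Complex.I * σ * g₂ s + g₃ s) s := by
      intro s
      have h1 : HasDerivAt (fun x : ℝ => (x : ℂ)) 1 s := Complex.ofRealCLM.hasDerivAt
      have h2 : HasDerivAt (fun x : ℝ => F (x * r)) (r • F' (s * r)) s := by
        have := (hder (s * r)).scomp s ((hasDerivAt_id s).mul_const r)
        simpa [Function.comp_def] using this
      have h3 := (h1.pow (2 * h + 1)).mul
        (((hη.hasDerivAt s).mul (hasDerivAt_cexp_I_mul_mul σ s)).mul h2)
      refine h3.congr_deriv ?_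
      simp only [hg₁, hg₂, hg₃, Complex.real_smul, Pi.mul_apply, Pi.pow_apply,
        Nat.add_sub_cancel]
      push_cast
      ring
    have hmain := schrodingerIntegral_id_mul (L := L) ht hGd (by fun_prop)
      (by simp [hG]) (by simp [hG, hη.apply_right])
    rw [schrodingerIntegral_add (by fun_prop) hg₃c, schrodingerIntegral_add hg₁c (by fun_prop),
      schrodingerIntegral_const_mul] at hmain
    have hfun : (fun s : ℝ => (s : ℂ) ^ (2 * (h + 1)) *
        (η s * Complex.exp (Complex.I * σ * s) * F (s * r))) = fun s : ℝ => s * G s := by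
      ext s; simp only [hG]; ring
    rw [hfun, hmain, norm_mul]
    have hc : ‖-(2 * Complex.I * (t : ℂ))⁻¹‖ ≤ |t|⁻¹ := by
      have : 0 < |t| := abs_pos.2 ht
      simp only [norm_neg, norm_inv, norm_mul, Complex.norm_ofNat, Complex.norm_I, mul_one,
        Complex.norm_real, Real.norm_eq_abs]
      gcongr; linarith
    calc _ ≤ |t|⁻¹ * (|C₁| * B + a * ((|C₂| + |C₄|) * B) + |C₃| * B) := by
          gcongr
          exact (norm_add₃_le).trans (by gcongr)
      _ ≤ |t|⁻¹ * ((|C₁| + |C₂| + |C₃| + |C₄|) * (B * (1 + a))) := by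
          gcongr
          have := abs_nonneg C₁
          have := abs_nonneg C₂
          have := abs_nonneg C₃
          have := abs_nonneg C₄
          have := mul_nonneg (mul_nonneg ha0 hB0) (add_nonneg (abs_nonneg C₁) (abs_nonneg C₃))
          have := mul_nonneg hB0 (add_nonneg (abs_nonneg C₂) (abs_nonneg C₄))
          nlinarith
      _ = _ := by rw [hB]; ring

/-! ### Poisson integrals as profiles -/

/-- The Poisson-type integral `∫_{-1}^1 e^{ius} P(s) ds`. -/
noncomputable def poissonProfile (P : Polynomial ℂ) (u : ℝ) : ℂ :=
  ∫ s in (-1 : ℝ)..1, Complex.exp (Complex.I * u * s) * P.eval (s : ℂ)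

lemma continuous_eval_ofReal (P : Polynomial ℂ) : Continuous fun s : ℝ => P.eval (s : ℂ) :=
  P.continuous.comp Complex.continuous_ofReal

lemma poissonProfile_C_mul (c : ℂ) (P : Polynomial ℂ) (u : ℝ) :
    poissonProfile (Polynomial.C c * P) u = c * poissonProfile P u := by
  unfold poissonProfile
  rw [← intervalIntegral.integral_const_mul]
  congr 1; ext s; simp; ring

lemma hasDerivAt_poissonProfile (P : Polynomial ℂ) (u : ℝ) :
    HasDerivAt (poissonProfile P) (Complex.I * poissonProfile (Polynomial.X * P) u) u := by
  have hP := continuous_eval_ofReal P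
  have h := (intervalIntegral.hasDerivAt_integral_of_dominated_loc_of_deriv_le
    (μ := volume) (a := (-1 : ℝ)) (b := 1)
    (F := fun (u s : ℝ) => Complex.exp (Complex.I * u * s) * P.eval (s : ℂ))
    (F' := fun (u s : ℝ) => Complex.exp (Complex.I * u * s) * (Complex.I * s) * P.eval (s : ℂ))
    (x₀ := u) (s := Set.univ) (bound := fun s => ‖(Complex.I * s) * P.eval (s : ℂ)‖)
    univ_mem ?_ ?_ ?_ ?_ ?_ ?_).2
  · refine h.congr_deriv ?_
    unfold poissonProfile
    rw [← intervalIntegral.integral_const_mul]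
    congr 1; ext s; simp; ring
  · exact Eventually.of_forall fun x => Continuous.aestronglyMeasurable (by fun_prop)
  · exact Continuous.intervalIntegrable (by fun_prop) _ _
  · exact Continuous.aestronglyMeasurable (by fun_prop)
  · refine ae_of_all _ fun s _ x _ => ?_
    rw [mul_assoc, norm_mul, norm_cexp_I_mul_mul, one_mul]
  · exact Continuous.intervalIntegrable (by fun_prop) _ _
  · refine ae_of_all _ fun s _ x _ => ?_
    have h1 : HasDerivAt (fun x : ℝ => (x : ℂ)) 1 x := Complex.ofRealCLM.hasDerivAt
    refine ((((h1.const_mul Complex.I).mul_const (s : ℂ)).cexp).mul_const _).congr_deriv ?_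
    ring

lemma continuous_poissonProfile (P : Polynomial ℂ) : Continuous (poissonProfile P) :=
  continuous_iff_continuousAt.2 fun u => (hasDerivAt_poissonProfile P u).continuousAt

/-- Integration by parts in `s`. -/
lemma I_mul_poissonProfile (P : Polynomial ℂ) (u : ℝ) :
    Complex.I * u * poissonProfile P u
      = P.eval 1 * Complex.exp (Complex.I * u) - P.eval (-1) * Complex.exp (-(Complex.I * u))
        - poissonProfile P.derivative u := by
  have hP := continuous_eval_ofReal P
  have hP' := continuous_eval_ofReal P.derivative
  have hparts := intervalIntegral.integral_mul_deriv_eq_deriv_mul (a := (-1 : ℝ)) (b := 1)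
    (fun s _ => (P.hasDerivAt (s : ℂ)).comp_ofReal)
    (fun s _ => hasDerivAt_cexp_I_mul_mul u s)
    (hP'.intervalIntegrable _ _) (Continuous.intervalIntegrable (by fun_prop) _ _)
  unfold poissonProfile
  rw [← intervalIntegral.integral_const_mul]
  calc _ = ∫ s in (-1 : ℝ)..1, P.eval (s : ℂ) *
        (Complex.exp (Complex.I * u * s) * (Complex.I * u)) := by
        congr 1; ext s; ring
    _ = _ := by
        rw [hparts]
        congr 1
        · simp
        · congr 1; ext s; ring

/-- Superpositions of phases `e^{iuθ}`, `|θ| ≤ 1`, are profiles of order `0`. -/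
lemma isProfile_zero {L : ℝ} (hL : 0 < L) (a b : ℂ) (P : Polynomial ℂ) :
    IsProfile L 0 (fun u => a * Complex.exp (Complex.I * u)
      + b * Complex.exp (-(Complex.I * u)) + poissonProfile P u) := by
  have hP := continuous_eval_ofReal P
  have hPc := continuous_poissonProfile P
  refine ⟨by fun_prop, fun η hη => ?_⟩
  have hηc := hη.continuous
  obtain ⟨C, hC⟩ := exists_schrodingerIntegral_le hL hη
  refine ⟨‖a‖ * C + ‖b‖ * C + (∫ s in (-1 : ℝ)..1, ‖P.eval (s : ℂ)‖) * C,
    fun t ht σ r hr => ?_⟩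
  set δ := |t| ^ (-(1 / 2) : ℝ)
  have hphase : ∀ θ : ℝ, ‖schrodingerIntegral L t
      (fun l => η l * Complex.exp (Complex.I * σ * l) * Complex.exp (Complex.I * (l * r : ℝ) * θ))‖
      ≤ C * δ := by
    intro θ
    refine le_trans (le_of_eq ?_) (hC t ht (σ + r * θ))
    congr 2
    ext l
    rw [mul_assoc, ← Complex.exp_add]
    congr 2
    push_cast; ring
  have hpois : schrodingerIntegral L t
      (fun l => η l * Complex.exp (Complex.I * σ * l) * poissonProfile P (l * r))
      = ∫ s in (-1 : ℝ)..1, P.eval (s : ℂ) * schrodingerIntegral L t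
        (fun l => η l * Complex.exp (Complex.I * σ * l)
          * Complex.exp (Complex.I * (l * r : ℝ) * s)) := by
    unfold schrodingerIntegral poissonProfile
    simp_rw [← intervalIntegral.integral_const_mul]
    rw [MeasureTheory.intervalIntegral_intervalIntegral_swap]
    · congr 1; ext s; congr 1; ext l; ring
    · refine IntegrableOn.mono_set (t := Set.uIcc 0 L ×ˢ Set.uIcc (-1) 1)
        (ContinuousOn.integrableOn_compact (isCompact_uIcc.prod isCompact_uIcc) ?_)
        (Set.prod_mono uIoc_subset_uIcc uIoc_subset_uIcc)
      refine Continuous.continuousOn ?_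
      unfold Function.uncurry
      fun_prop
  have hsplit : (fun l : ℝ => η l * Complex.exp (Complex.I * σ * l) *
        (a * Complex.exp (Complex.I * (l * r : ℝ)) + b * Complex.exp (-(Complex.I * (l * r : ℝ)))
          + poissonProfile P (l * r)))
      = fun l => (a * (η l * Complex.exp (Complex.I * σ * l)
            * Complex.exp (Complex.I * (l * r : ℝ) * (1 : ℝ)))
          + b * (η l * Complex.exp (Complex.I * σ * l)
            * Complex.exp (Complex.I * (l * r : ℝ) * (-1 : ℝ))))
          + η l * Complex.exp (Complex.I * σ * l) * poissonProfile P (l * r) := by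
    ext l; push_cast; simp only [mul_one, mul_neg]; ring
  rw [hsplit, schrodingerIntegral_add (by fun_prop) (by fun_prop),
    schrodingerIntegral_add (by fun_prop) (by fun_prop), schrodingerIntegral_const_mul,
    schrodingerIntegral_const_mul, hpois]
  refine norm_add₃_le.trans ?_
  rw [norm_mul, norm_mul, add_mul, add_mul, mul_assoc, mul_assoc, mul_assoc]
  gcongr
  · exact hphase 1
  · exact hphase (-1)
  · rw [← intervalIntegral.integral_mul_const]
    refine intervalIntegral.norm_integral_le_of_norm_le (by norm_num) (ae_of_all _ fun s _ => ?_)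
      (Continuous.intervalIntegrable (by fun_prop) _ _)
    rw [norm_mul]
    gcongr
    exact hphase s

/-- Each order of vanishing of `P` at `±1` allows one more integration by parts in `s` without
boundary terms. -/
lemma isProfile_poissonProfile {L : ℝ} (hL : 0 < L) (h : ℕ) :
    ∀ P : Polynomial ℂ, (1 - Polynomial.X ^ 2) ^ h ∣ P → IsProfile L (h + 1) (poissonProfile P) := by
  have hu : ∀ (Q : Polynomial ℂ) (u : ℝ), (u : ℂ) * poissonProfile Q u
      = -Complex.I * (Complex.I * u * poissonProfile Q u) := by
    intro Q u
    linear_combination ((u : ℂ) * poissonProfile Q u) * Complex.I_sq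
  have hmul : ∀ (Q : Polynomial ℂ), 1 - Polynomial.X ^ 2 ∣ Q → ∀ u : ℝ,
      (u : ℂ) * poissonProfile Q u
        = poissonProfile (Polynomial.C Complex.I * Q.derivative) u := by
    rintro Q ⟨R, rfl⟩ u
    rw [hu, I_mul_poissonProfile, poissonProfile_C_mul]
    simp
  induction h with
  | zero =>
    intro P _
    have h0 : ∀ Q, IsProfile L 0 (poissonProfile Q) := fun Q => by
      simpa using isProfile_zero hL 0 0 Q
    have h1 : ∀ Q : Polynomial ℂ, IsProfile L 0 (fun u => (u : ℂ) * poissonProfile Q u) := by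
      intro Q
      have he : (fun u : ℝ => (u : ℂ) * poissonProfile Q u) = fun u : ℝ =>
          (-Complex.I * Q.eval 1) * Complex.exp (Complex.I * u)
          + (Complex.I * Q.eval (-1)) * Complex.exp (-(Complex.I * u))
          + poissonProfile (Polynomial.C Complex.I * Q.derivative) u := by
        ext u
        rw [hu, I_mul_poissonProfile, poissonProfile_C_mul]
        ring
      rw [he]
      exact isProfile_zero hL _ _ _
    refine ⟨h0 P, _, hasDerivAt_poissonProfile P,
      continuous_const.mul (continuous_poissonProfile _), ?_, h1 P⟩
    simp_rw [← poissonProfile_C_mul Complex.I]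
    exact h1 _
  | succ h ih =>
    intro P hP
    have hdvd : ∀ Q : Polynomial ℂ, (1 - Polynomial.X ^ 2) ^ (h + 1) ∣ Q →
        IsProfile L (h + 1) (fun u => (u : ℂ) * poissonProfile Q u) := by
      intro Q hQ
      have h1 : 1 - Polynomial.X ^ 2 ∣ Q := Dvd.dvd.trans
        (dvd_pow_self (1 - Polynomial.X ^ 2 : Polynomial ℂ) h.succ_ne_zero) hQ
      simp_rw [hmul Q h1]
      have h2 := Polynomial.pow_sub_one_dvd_derivative_of_pow_dvd hQ
      rw [Nat.add_sub_cancel] at h2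
      exact ih _ (h2.mul_left _)
    refine ⟨ih P ((pow_dvd_pow _ h.le_succ).trans hP), _, hasDerivAt_poissonProfile P,
      continuous_const.mul (continuous_poissonProfile _), ?_, hdvd P hP⟩
    simp_rw [← poissonProfile_C_mul Complex.I]
    exact hdvd _ ((hP.mul_left _).mul_left _)

/-! ### Poisson's integral for the free resolvent kernel -/

/-- The polynomial factor of the free resolvent kernel in dimension `2M + 3`, in the variable
`u = λr` (a reverse Bessel polynomial). -/
noncomputable def greenPoly (M : ℕ) : Polynomial ℂ :=
  ∑ l ∈ Finset.range (M + 1), Polynomial.C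
    ((((2 * M - l)! : ℂ) / ((l ! : ℂ) * ((M - l)! : ℂ))) * (-2 * Complex.I) ^ l)
      * Polynomial.X ^ l

lemma coeff_greenPoly (M l : ℕ) : (greenPoly M).coeff l = if l ≤ M then
    (((2 * M - l)! : ℂ) / ((l ! : ℂ) * ((M - l)! : ℂ))) * (-2 * Complex.I) ^ l else 0 := by
  simp only [greenPoly, Polynomial.finsetSum_coeff, Polynomial.coeff_C_mul_X_pow,
    Finset.sum_ite_eq, Finset.mem_range, Nat.lt_succ_iff]

/-- The recursion that corresponds to `𝒢_{n+2} = -(2πr)⁻¹ ∂_r 𝒢_n`. -/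
lemma greenPoly_succ (M : ℕ) : greenPoly (M + 1)
    = Polynomial.C (-2) * (Polynomial.X * (greenPoly M).derivative
      + Polynomial.C Complex.I * (Polynomial.X * greenPoly M)
      - Polynomial.C (2 * M + 1 : ℂ) * greenPoly M) := by
  have hf : ∀ k : ℕ, (k ! : ℂ) ≠ 0 := fun k => by exact_mod_cast k.factorial_ne_zero
  ext l
  rcases l with _ | l
  · simp only [Polynomial.coeff_sub, Polynomial.coeff_add, Polynomial.mul_coeff_zero,
      Polynomial.coeff_X_zero, coeff_greenPoly]
    have h1 : (2 * (M + 1))! = (2 * M + 2) * ((2 * M + 1) * (2 * M)!) := by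
      rw [show 2 * (M + 1) = 2 * M + 1 + 1 by ring, Nat.factorial_succ, Nat.factorial_succ]
    have h2 : (M + 1)! = (M + 1) * M ! := Nat.factorial_succ M
    have := hf M
    have h3 : (M : ℂ) + 1 ≠ 0 := by exact_mod_cast M.succ_ne_zero
    simp [h1, h2]
    field_simp
  · simp only [Polynomial.coeff_C_mul, Polynomial.coeff_sub, Polynomial.coeff_add,
      Polynomial.coeff_X_mul, Polynomial.coeff_derivative, coeff_greenPoly]
    rcases lt_trichotomy l M with h | h | h
    · obtain ⟨d, rfl⟩ : ∃ d, M = l + 1 + d := ⟨M - (l + 1), by omega⟩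
      rw [if_pos (by omega), if_pos (by omega), if_pos (by omega),
        show 2 * (l + 1 + d + 1) - (l + 1) = l + 2 * d + 1 + 1 + 1 by omega,
        show l + 1 + d + 1 - (l + 1) = d + 1 by omega,
        show 2 * (l + 1 + d) - (l + 1) = l + 2 * d + 1 by omega,
        show l + 1 + d - (l + 1) = d by omega,
        show 2 * (l + 1 + d) - l = l + 2 * d + 1 + 1 by omega,
        show l + 1 + d - l = d + 1 by omega]
      have h1 := hf l
      have h2 := hf d
      have h3 : (l : ℂ) + 1 ≠ 0 := by exact_mod_cast l.succ_ne_zero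
      have h4 : (d : ℂ) + 1 ≠ 0 := by exact_mod_cast d.succ_ne_zero
      simp only [Nat.factorial_succ (l + 2 * d + 1 + 1), Nat.factorial_succ (l + 2 * d + 1),
        Nat.factorial_succ l, Nat.factorial_succ d]
      push_cast
      field_simp
      ring_nf
    · subst h
      rw [if_pos (by omega), if_neg (by omega), if_pos le_rfl,
        show 2 * (l + 1) - (l + 1) = l + 1 by omega, show 2 * l - l = l by omega]
      have h1 := hf l
      have h3 : (l : ℂ) + 1 ≠ 0 := by exact_mod_cast l.succ_ne_zero
      simp only [Nat.factorial_succ l, Nat.sub_self, Nat.factorial_zero]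
      push_cast
      field_simp
      ring
    · rw [if_neg (by omega), if_neg (by omega), if_neg (by omega)]
      simp

/-- Poisson's integral for the difference of the outgoing and the incoming kernel, which shows that
it vanishes to order `2M + 1` at `u = 0`. The proof is by induction on `M`: differentiating the
identity matches `greenPoly_succ` with `u E_{M+1}(u) = -2 (M + 1) E_M'(u)`. -/
lemma exists_greenPoly_sub_eq (M : ℕ) : ∃ κ : ℂ, ∀ u : ℝ,
    Complex.exp (Complex.I * u) * (greenPoly M).eval (u : ℂ)
      - Complex.exp (-(Complex.I * u)) * (greenPoly M).eval (-(u : ℂ))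
      = κ * u ^ (2 * M + 1) * poissonProfile ((1 - Polynomial.X ^ 2) ^ M) u := by
  induction M with
  | zero =>
    refine ⟨Complex.I, fun u => ?_⟩
    have := I_mul_poissonProfile 1 u
    rw [Polynomial.derivative_one, show poissonProfile 0 u = 0 by simp [poissonProfile]] at this
    simp only [Polynomial.eval_one] at this
    simp [greenPoly]
    rw [this]; ring
  | succ M ih =>
    obtain ⟨κ, hκ⟩ := ih
    refine ⟨κ * (M + 1 : ℂ)⁻¹, fun u => ?_⟩
    set p := greenPoly M with hp
    set W : Polynomial ℂ := (1 - Polynomial.X ^ 2) ^ M with hW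
    have hM : (M + 1 : ℂ) ≠ 0 := by exact_mod_cast M.succ_ne_zero
    have hid : HasDerivAt (fun x : ℝ => (x : ℂ)) 1 u := Complex.ofRealCLM.hasDerivAt
    have hl1 := (hid.const_mul Complex.I).cexp.mul ((p.hasDerivAt (u : ℂ)).comp_ofReal)
    have hneg : HasDerivAt (fun x : ℝ => p.eval (-(x : ℂ))) (-p.derivative.eval (-(u : ℂ))) u := by
      have := ((p.hasDerivAt (-(u : ℂ))).scomp (u : ℂ) (hasDerivAt_neg (u : ℂ))).comp_ofReal
      simpa [Function.comp_def] using this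
    have hl2 := (hid.const_mul Complex.I).neg.cexp.mul hneg
    have hl := hl1.sub hl2
    have hr := ((hid.pow (2 * M + 1)).const_mul κ).mul (hasDerivAt_poissonProfile W u)
    have hfun : ((fun x : ℝ => Complex.exp (Complex.I * x)) * fun x : ℝ => p.eval (x : ℂ))
        - ((fun x : ℝ => Complex.exp (-(Complex.I * x))) * fun x : ℝ => p.eval (-(x : ℂ)))
        = (fun x : ℝ => κ * ((fun x : ℝ => (x : ℂ)) ^ (2 * M + 1)) x) * poissonProfile W := by
      ext x
      simpa using hκ x
    have hdeq := hl.unique (hfun ▸ hr)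
    -- `u E_{M+1}(u) = -2 (M + 1) E_M'(u)` by parts
    have hE := I_mul_poissonProfile ((1 - Polynomial.X ^ 2) ^ (M + 1)) u
    have hder : Polynomial.derivative ((1 - Polynomial.X ^ 2 : Polynomial ℂ) ^ (M + 1))
        = Polynomial.C (-2 * (M + 1) : ℂ) * (Polynomial.X * W) := by
      rw [Polynomial.derivative_pow_succ, hW]
      have : (Polynomial.C 2 : Polynomial ℂ) = 2 := rfl
      simp [this]
      ring
    rw [hder, poissonProfile_C_mul] at hE
    simp only [Polynomial.eval_pow, Polynomial.eval_sub, Polynomial.eval_one, Polynomial.eval_X,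
      one_pow, sub_self, even_two, Even.neg_pow, ne_eq, Nat.add_eq_zero_iff, one_ne_zero, and_false,
      not_false_eq_true, zero_pow, zero_mul, zero_sub] at hE
    have hu := hκ u
    rw [greenPoly_succ]
    simp only [Polynomial.eval_mul, Polynomial.eval_C, Polynomial.eval_sub, Polynomial.eval_add,
      Polynomial.eval_X, ← hp]
    simp only [Pi.neg_apply, Pi.pow_apply, Nat.add_sub_cancel] at hdeq
    push_cast at hdeq
    have hE' : (u : ℂ) * poissonProfile ((1 - Polynomial.X ^ 2) ^ (M + 1)) u
        = -(2 * Complex.I * (M + 1)) * poissonProfile (Polynomial.X * W) u := by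
      linear_combination -Complex.I * hE
        + (u : ℂ) * poissonProfile ((1 - Polynomial.X ^ 2) ^ (M + 1)) u * Complex.I_sq
    have hR : κ * (M + 1 : ℂ)⁻¹ * (u : ℂ) ^ (2 * (M + 1) + 1)
          * poissonProfile ((1 - Polynomial.X ^ 2) ^ (M + 1)) u
        = -(2 * Complex.I) * κ * (u : ℂ) ^ (2 * M + 2) * poissonProfile (Polynomial.X * W) u := by
      calc _ = κ * (M + 1 : ℂ)⁻¹ * (u : ℂ) ^ (2 * M + 2)
            * (u * poissonProfile ((1 - Polynomial.X ^ 2) ^ (M + 1)) u) := by ring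
        _ = _ := by rw [hE']; field_simp
    rw [hR]
    linear_combination (-2 * (u : ℂ)) * hdeq + 2 * (2 * M + 1 : ℂ) * hu

/-! ### The majorant of the free resolvent kernel -/

/-- The constant `C_n` of the free resolvent kernel in dimension `n = 2M + 3`. -/
noncomputable def greenConst (M : ℕ) : ℂ := (((4 * Real.pi) ^ (M + 1))⁻¹ : ℝ)

lemma freeGreen_eq (M : ℕ) (lam r : ℝ) : freeGreen (2 * M + 3) lam r
    = greenConst M * (Complex.exp (Complex.I * lam * r) / (r : ℂ) ^ (2 * M + 1))
      * (greenPoly M).eval ((lam * r : ℝ) : ℂ) := by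
  have h1 : (2 * M + 3 - 1) / 2 = M + 1 := by omega
  have h2 : (2 * M + 3 - 3) / 2 = M := by omega
  have h3 : 2 * M + 3 - 2 = 2 * M + 1 := by omega
  have h4 : 2 * M + 3 - 3 = 2 * M := by omega
  unfold freeGreen
  rw [h1, h2, h3, greenConst, greenPoly, Polynomial.eval_finsetSum]
  congr 1
  refine Finset.sum_congr rfl fun l _ => ?_
  rw [h4]
  simp only [Polynomial.eval_mul, Polynomial.eval_C, Polynomial.eval_pow, Polynomial.eval_X]
  rw [show -2 * Complex.I * (r : ℂ) * lam = (-2 * Complex.I) * ((lam * r : ℝ) : ℂ) by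
    push_cast; ring, mul_pow]
  ring

lemma continuous_freeGreen (n : ℕ) (ε r : ℝ) : Continuous fun s : ℝ => freeGreen n (ε * s) r := by
  unfold freeGreen
  fun_prop

/-- The majorant `r^{-(2M+1)} + r^{-(M+1)}` of the free resolvent kernel in dimension `2M + 3`:
the Newtonian singularity and the decay of an outgoing wave. -/
noncomputable def greenMajorant (M : ℕ) (r : ℝ) : ℝ := (r ^ (2 * M + 1))⁻¹ + (r ^ (M + 1))⁻¹

lemma greenMajorant_nonneg (M : ℕ) {r : ℝ} (hr : 0 ≤ r) : 0 ≤ greenMajorant M r := by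
  unfold greenMajorant; positivity

lemma pow_mul_inv_le_greenMajorant {M q : ℕ} (hq : q ≤ M) {r : ℝ} (hr : 0 < r) :
    r ^ q * (r ^ (2 * M + 1))⁻¹ ≤ greenMajorant M r := by
  unfold greenMajorant
  have h0 : 0 < (r ^ (2 * M + 1))⁻¹ := by positivity
  have h1 : 0 < (r ^ (M + 1))⁻¹ := by positivity
  rcases le_total r 1 with h | h
  · have : r ^ q ≤ 1 := pow_le_one₀ hr.le h
    nlinarith
  · have h2 : r ^ q ≤ r ^ M := pow_le_pow_right₀ h hq
    have h3 : r ^ M * (r ^ (2 * M + 1))⁻¹ = (r ^ (M + 1))⁻¹ := by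
      rw [show 2 * M + 1 = M + (M + 1) by ring, pow_add r M (M + 1)]
      field_simp
    nlinarith

lemma inv_max_pow_le_greenMajorant (M : ℕ) {r : ℝ} (hr : 0 < r) :
    ((max 1 r) ^ (M + 1))⁻¹ ≤ greenMajorant M r := by
  have h0 : 0 < (r ^ (2 * M + 1))⁻¹ := by positivity
  have : (max 1 r ^ (M + 1))⁻¹ ≤ (r ^ (M + 1))⁻¹ := by
    gcongr; exact le_max_right _ _
  unfold greenMajorant; linarith

lemma pow_mul_greenMajorant_le (M : ℕ) {r : ℝ} (hr : 0 < r) :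
    r ^ (M + 1) * greenMajorant M r ≤ greenMajorant M r + 2 := by
  have h0 : 0 < (r ^ (2 * M + 1))⁻¹ := by positivity
  have h1 : 0 < (r ^ (M + 1))⁻¹ := by positivity
  rcases le_total r 1 with h | h
  · have : r ^ (M + 1) ≤ 1 := pow_le_one₀ hr.le h
    have := mul_le_mul_of_nonneg_right this (greenMajorant_nonneg M hr.le)
    linarith
  · have h3 : r ^ (M + 1) * greenMajorant M r = (r ^ M)⁻¹ + 1 := by
      unfold greenMajorant
      rw [show 2 * M + 1 = M + (M + 1) by ring, pow_add r M (M + 1)]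
      field_simp
    have h4 : (r ^ M)⁻¹ ≤ 1 := inv_le_one_of_one_le₀ (one_le_pow₀ h)
    have := greenMajorant_nonneg M hr.le
    linarith

/-- The product of the majorants along a path with step lengths `rs`. -/
noncomputable def majorantProd (M : ℕ) (rs : List ℝ) : ℝ := (rs.map (greenMajorant M)).prod

/-- The sum, over the steps of a path, of the product of the majorants of all other steps. -/
noncomputable def majorantWeight (M : ℕ) : List ℝ → ℝ
  | [] => 0
  | r :: rs => greenMajorant M r * majorantWeight M rs + majorantProd M rs

lemma majorantProd_cons (M : ℕ) (r : ℝ) (rs : List ℝ) :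
    majorantProd M (r :: rs) = greenMajorant M r * majorantProd M rs := by
  simp [majorantProd]

lemma majorantProd_nonneg (M : ℕ) : ∀ {rs : List ℝ}, (∀ r ∈ rs, 0 < r) → 0 ≤ majorantProd M rs
  | [], _ => by simp [majorantProd]
  | r :: rs, h => by
    rw [majorantProd_cons]
    exact mul_nonneg (greenMajorant_nonneg M (h r (by simp)).le)
      (majorantProd_nonneg M fun x hx => h x (by simp [hx]))

lemma majorantWeight_nonneg (M : ℕ) : ∀ {rs : List ℝ}, (∀ r ∈ rs, 0 < r) → 0 ≤ majorantWeight M rs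
  | [], _ => le_rfl
  | r :: rs, h => add_nonneg (mul_nonneg (greenMajorant_nonneg M (h r (by simp)).le)
      (majorantWeight_nonneg M fun x hx => h x (by simp [hx])))
      (majorantProd_nonneg M fun x hx => h x (by simp [hx]))

lemma majorantWeight_perm (M : ℕ) {l₁ l₂ : List ℝ} (h : l₁.Perm l₂) :
    majorantWeight M l₁ = majorantWeight M l₂ := by
  induction h with
  | nil => rfl
  | cons r h ih =>
    simp only [majorantWeight, ih]
    rw [majorantProd, majorantProd, (h.map _).prod_eq]
  | swap r s l => simp only [majorantWeight, majorantProd_cons]; ring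
  | trans _ _ ih₁ ih₂ => exact ih₁.trans ih₂

/-! ### The oscillatory integral along a path with given step lengths -/

/-- The product of the kernels `𝒢_n(ε λ, r)` over a list of signed steps `(ε, r)`. -/
noncomputable def greenProd (n : ℕ) (P : List (ℝ × ℝ)) (lam : ℝ) : ℂ :=
  (P.map fun p => freeGreen n (p.1 * lam) p.2).prod

lemma greenProd_cons (n : ℕ) (p : ℝ × ℝ) (P : List (ℝ × ℝ)) (lam : ℝ) :
    greenProd n (p :: P) lam = freeGreen n (p.1 * lam) p.2 * greenProd n P lam := by
  simp [greenProd]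

lemma greenProd_append (n : ℕ) (P Q : List (ℝ × ℝ)) (lam : ℝ) :
    greenProd n (P ++ Q) lam = greenProd n P lam * greenProd n Q lam := by
  simp [greenProd]

lemma continuous_greenProd (n : ℕ) : ∀ P : List (ℝ × ℝ), Continuous (greenProd n P)
  | [] => by
    have : greenProd n [] = fun _ => 1 := by ext; simp [greenProd]
    rw [this]; exact continuous_const
  | p :: P => by
    rw [show greenProd n (p :: P) = fun s => freeGreen n (p.1 * s) p.2 * greenProd n P s from
      funext (greenProd_cons n p P)]
    exact (continuous_freeGreen n p.1 p.2).mul (continuous_greenProd n P)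

/-- The weight inequality behind `exists_profile_greenProd_bound`: attaching a step of length `r'`
to the phase. A growing factor `r'^{M+1}` uses up the decay of its own majorant, and the factor
`(max 1 r)^{-(M+1)}` which pays for it becomes the majorant of the distinguished step. -/
lemma weight_step (M : ℕ) {r r' σ σ' B W : ℝ} (hr : 0 < r) (hr' : 0 < r')
    (hσ : |σ'| ≤ |σ| + r') (hB : 0 ≤ B) (hW : 0 ≤ W) :
    greenMajorant M r' * ((1 + (|σ'| / max 1 r) ^ (M + 1)) * B + greenMajorant M r * W)
      ≤ 2 ^ (M + 2) * ((1 + (|σ| / max 1 r) ^ (M + 1)) * (greenMajorant M r' * B)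
        + greenMajorant M r * (greenMajorant M r' * W + B)) := by
  set m := max 1 r with hm
  have hm1 : 1 ≤ m := le_max_left _ _
  have hm0 : 0 < m := by linarith
  set K := greenMajorant M r with hK
  set K' := greenMajorant M r' with hK'
  have hK0 : 0 ≤ K := greenMajorant_nonneg M hr.le
  have hK'0 : 0 ≤ K' := greenMajorant_nonneg M hr'.le
  set S := (|σ| / m) ^ (M + 1) with hS
  have hS0 : 0 ≤ S := by positivity
  have h1 : (|σ'| / m) ^ (M + 1) ≤ 2 ^ M * (S + r' ^ (M + 1) * (m ^ (M + 1))⁻¹) := by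
    calc (|σ'| / m) ^ (M + 1) ≤ (|σ| / m + r' / m) ^ (M + 1) := by
          rw [← add_div]; gcongr
      _ ≤ 2 ^ M * (S + (r' / m) ^ (M + 1)) := add_pow_le (by positivity) (by positivity) _
      _ = _ := by rw [div_pow r', div_eq_mul_inv]
  have h2 : (m ^ (M + 1))⁻¹ ≤ K := inv_max_pow_le_greenMajorant M hr
  have h2' : (m ^ (M + 1))⁻¹ ≤ 1 := inv_le_one_of_one_le₀ (one_le_pow₀ hm1)
  have h20 : 0 ≤ (m ^ (M + 1))⁻¹ := by positivity
  have h3 : r' ^ (M + 1) * K' ≤ K' + 2 := pow_mul_greenMajorant_le M hr'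
  have h4 : K' * (r' ^ (M + 1) * (m ^ (M + 1))⁻¹) ≤ K' + 2 * K := by
    calc _ = (r' ^ (M + 1) * K') * (m ^ (M + 1))⁻¹ := by ring
      _ ≤ (K' + 2) * (m ^ (M + 1))⁻¹ := by gcongr
      _ ≤ K' + 2 * K := by nlinarith
  have h5 : K' * (|σ'| / m) ^ (M + 1) ≤ 2 ^ M * (K' * S + K' + 2 * K) := by
    calc _ ≤ K' * (2 ^ M * (S + r' ^ (M + 1) * (m ^ (M + 1))⁻¹)) := by gcongr
      _ = 2 ^ M * (K' * S + K' * (r' ^ (M + 1) * (m ^ (M + 1))⁻¹)) := by ring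
      _ ≤ _ := mul_le_mul_of_nonneg_left (by linarith) (by positivity)
  have hp : (1 : ℝ) ≤ 2 ^ M := one_le_pow₀ (by norm_num)
  set A : ℝ := 2 ^ M with hA
  have e1 : 0 ≤ K' * B := mul_nonneg hK'0 hB
  have e2 : 0 ≤ K * B := mul_nonneg hK0 hB
  have e3 : 0 ≤ K * K' * W := mul_nonneg (mul_nonneg hK0 hK'0) hW
  have e4 : 0 ≤ K' * S * B := mul_nonneg (mul_nonneg hK'0 hS0) hB
  calc _ = K' * B + (K' * (|σ'| / m) ^ (M + 1)) * B + K * K' * W := by ring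
    _ ≤ K' * B + (A * (K' * S + K' + 2 * K)) * B + K * K' * W := by gcongr
    _ ≤ _ := by
      rw [pow_add, ← hA]
      nlinarith [mul_le_mul_of_nonneg_right hp e1, mul_le_mul_of_nonneg_right hp e3,
        mul_nonneg (zero_le_one.trans hp) e1, mul_nonneg (zero_le_one.trans hp) e2,
        mul_nonneg (zero_le_one.trans hp) e3, mul_nonneg (zero_le_one.trans hp) e4]

/-- Oscillatory integral with a profile in one step and resolvent kernels in all others. -/
lemma exists_profile_greenProd_bound {L : ℝ} (M : ℕ) {F : ℝ → ℂ} (hF : IsProfile L (M + 1) F)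
    (k : ℕ) : ∀ η, IsAmplitude L η → ∃ C : ℝ, 0 ≤ C ∧ ∀ P : List (ℝ × ℝ), P.length = k →
      (∀ p ∈ P, |p.1| = 1 ∧ 0 < p.2) → ∀ t : ℝ, t ≠ 0 → ∀ σ r : ℝ, 0 < r →
      ‖schrodingerIntegral L t (fun s => (s : ℂ) ^ (2 * (M + 1)) *
        (η s * Complex.exp (Complex.I * σ * s) * F (s * r)) * greenProd (2 * M + 3) P s)‖
      ≤ C * (|t| ^ (-(1 / 2) : ℝ) * |t|⁻¹ ^ (M + 1)) *
        ((1 + (|σ| / max 1 r) ^ (M + 1)) * majorantProd M (P.map Prod.snd)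
          + greenMajorant M r * majorantWeight M (P.map Prod.snd)) := by
  have hFc := hF.continuous
  induction k with
  | zero =>
    intro η hη
    obtain ⟨C, hC⟩ := hF.exists_bound hη
    refine ⟨2 ^ M * |C|, by positivity, fun P hP _ t ht σ r hr => ?_⟩
    rw [List.length_eq_zero_iff] at hP
    subst hP
    simp only [greenProd, List.map_nil, List.prod_nil, mul_one, majorantProd, majorantWeight,
      mul_zero, add_zero]
    set a := |σ| / max 1 r with ha
    have ha0 : 0 ≤ a := by have := le_max_left 1 r; positivity
    have h1 : (1 + a) ^ (M + 1) ≤ 2 ^ M * (1 + a ^ (M + 1)) := by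
      simpa using add_pow_le zero_le_one ha0 (M + 1)
    calc _ ≤ C * (|t| ^ (-(1 / 2) : ℝ) * |t|⁻¹ ^ (M + 1) * (1 + a) ^ (M + 1)) := hC t ht σ r hr
      _ ≤ |C| * (|t| ^ (-(1 / 2) : ℝ) * |t|⁻¹ ^ (M + 1) * (2 ^ M * (1 + a ^ (M + 1)))) := by
          gcongr; exact le_abs_self C
      _ = _ := by ring
  | succ k ih =>
    intro η hη
    have hηc := hη.continuous
    choose C hC0 hC using fun q : ℕ => ih _ (hη.pow_mul q)
    set c : ℕ → ℝ := fun q => ‖greenConst M * (greenPoly M).coeff q‖ with hc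
    refine ⟨2 ^ (M + 2) * ∑ q ∈ Finset.range (M + 1), c q * C q,
      mul_nonneg (by positivity)
        (Finset.sum_nonneg fun q _ => mul_nonneg (norm_nonneg _) (hC0 q)), ?_⟩
    rintro (_ | ⟨⟨ε, r'⟩, P⟩) hlen hP t ht σ r hr
    · simp at hlen
    have hlen' : P.length = k := by simpa using hlen
    have hP' : ∀ p ∈ P, |p.1| = 1 ∧ 0 < p.2 := fun p hp => hP p (by simp [hp])
    obtain ⟨hε, hr'⟩ : |ε| = 1 ∧ 0 < r' := hP (ε, r') (by simp)
    have hpos : ∀ x ∈ P.map Prod.snd, 0 < x := by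
      intro x hx
      obtain ⟨p, hp, rfl⟩ := List.mem_map.1 hx
      exact (hP' p hp).2
    have hdeg : (greenPoly M).natDegree < M + 1 := by
      rw [Nat.lt_succ_iff, Polynomial.natDegree_le_iff_coeff_eq_zero]
      intro q hq
      rw [coeff_greenPoly, if_neg (by omega)]
    set T := |t| ^ (-(1 / 2) : ℝ) * |t|⁻¹ ^ (M + 1) with hT
    have hT0 : 0 ≤ T := by positivity
    set κ : ℕ → ℂ := fun q => greenConst M * (greenPoly M).coeff q * (ε : ℂ) ^ q
      * ((r' : ℂ) ^ q * ((r' : ℂ) ^ (2 * M + 1))⁻¹) with hκ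
    have hκn : ∀ q ∈ Finset.range (M + 1), ‖κ q‖ ≤ c q * greenMajorant M r' := by
      intro q hq
      simp only [hκ, hc, norm_mul, norm_pow, norm_inv, Complex.norm_real, Real.norm_eq_abs, hε,
        one_pow, mul_one, abs_of_pos hr']
      gcongr
      exact pow_mul_inv_le_greenMajorant (Nat.lt_succ_iff.1 (Finset.mem_range.1 hq)) hr'
    set g : ℕ → ℝ → ℂ := fun q s => (s : ℂ) ^ (2 * (M + 1)) *
        (((s : ℂ) ^ q * η s) * Complex.exp (Complex.I * (σ + ε * r' : ℝ) * s) * F (s * r))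
          * greenProd (2 * M + 3) P s with hg
    have hgc : ∀ q, Continuous (g q) := by
      intro q
      have := continuous_greenProd (2 * M + 3) P
      fun_prop
    have hexp : (fun s : ℝ => (s : ℂ) ^ (2 * (M + 1)) *
        (η s * Complex.exp (Complex.I * σ * s) * F (s * r))
          * greenProd (2 * M + 3) ((ε, r') :: P) s)
        = fun s => ∑ q ∈ Finset.range (M + 1), κ q * g q s := by
      ext s
      rw [greenProd_cons, freeGreen_eq, Polynomial.eval_eq_sum_range' hdeg]
      simp only [Finset.mul_sum, Finset.sum_mul]
      refine Finset.sum_congr rfl fun q _ => ?_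
      have he : Complex.exp (Complex.I * (σ + ε * r' : ℝ) * s)
          = Complex.exp (Complex.I * σ * s) * Complex.exp (Complex.I * (ε * s : ℝ) * r') := by
        rw [← Complex.exp_add]; congr 1; push_cast; ring
      simp only [hκ, hg, he]
      push_cast
      rw [div_eq_mul_inv]
      ring
    rw [hexp, schrodingerIntegral_sum _ (fun q s => κ q * g q s) fun q _ => continuous_const.mul (hgc q)]
    simp_rw [schrodingerIntegral_const_mul]
    have hσ' : |σ + ε * r'| ≤ |σ| + r' := by
      refine (abs_add_le _ _).trans ?_
      rw [abs_mul, hε, one_mul, abs_of_pos hr']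
    have hPi := majorantProd_nonneg M hpos
    have hWe := majorantWeight_nonneg M hpos
    simp only [List.map_cons, majorantProd_cons, majorantWeight]
    set B := majorantProd M (P.map Prod.snd)
    set W := majorantWeight M (P.map Prod.snd)
    have hws := weight_step M hr hr' hσ' hPi hWe
    calc _ ≤ ∑ q ∈ Finset.range (M + 1), (c q * greenMajorant M r') * (C q * T *
          ((1 + (|σ + ε * r'| / max 1 r) ^ (M + 1)) * B + greenMajorant M r * W)) := by
          refine norm_sum_le_of_le _ fun q hq => ?_
          rw [norm_mul]
          have hKr' := greenMajorant_nonneg M hr'.le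
          exact mul_le_mul (hκn q hq) (hC q P hlen' hP' t ht _ r hr) (norm_nonneg _)
            (mul_nonneg (norm_nonneg _) hKr')
      _ = (∑ q ∈ Finset.range (M + 1), c q * C q) * T * (greenMajorant M r' *
          ((1 + (|σ + ε * r'| / max 1 r) ^ (M + 1)) * B + greenMajorant M r * W)) := by
          rw [Finset.sum_mul, Finset.sum_mul]
          exact Finset.sum_congr rfl fun q _ => by ring
      _ ≤ (∑ q ∈ Finset.range (M + 1), c q * C q) * T * (2 ^ (M + 2) * _) := by
          refine mul_le_mul_of_nonneg_left hws (mul_nonneg ?_ hT0)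
          exact Finset.sum_nonneg fun q _ => mul_nonneg (norm_nonneg _) (hC0 q)
      _ = _ := by ring

/-- The difference of the outgoing and the incoming kernel is `λ^{2M+1}` times a profile. -/
lemma exists_freeGreen_sub_eq (M : ℕ) : ∃ κ : ℂ, ∀ lam r : ℝ, 0 < r →
    freeGreen (2 * M + 3) lam r - freeGreen (2 * M + 3) (-lam) r
      = κ * lam ^ (2 * M + 1) * poissonProfile ((1 - Polynomial.X ^ 2) ^ M) (lam * r) := by
  obtain ⟨κ, hκ⟩ := exists_greenPoly_sub_eq M
  refine ⟨greenConst M * κ, fun lam r hr => ?_⟩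
  have hrC : (r : ℂ) ≠ 0 := by exact_mod_cast hr.ne'
  have h := hκ (lam * r)
  have e1 : Complex.exp (Complex.I * lam * r) = Complex.exp (Complex.I * (lam * r : ℝ)) := by
    congr 1; push_cast; ring
  have e2 : Complex.exp (Complex.I * (-lam : ℝ) * r)
      = Complex.exp (-(Complex.I * (lam * r : ℝ))) := by
    congr 1; push_cast; ring
  have e3 : ((-lam * r : ℝ) : ℂ) = -((lam * r : ℝ) : ℂ) := by push_cast; ring
  rw [freeGreen_eq, freeGreen_eq, e1, e2, e3]
  calc _ = greenConst M * ((r : ℂ) ^ (2 * M + 1))⁻¹ * _ := by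
        rw [div_eq_mul_inv, div_eq_mul_inv]
        rw [show ∀ a b c d e f : ℂ, a * (b * c) * d - a * (e * c) * f = a * c * (b * d - e * f) by
          intros; ring]
    _ = _ := by
        rw [h]; push_cast; rw [mul_pow]; field_simp

/-- The dispersive bound for a path with given step lengths: the difference of the two products is
telescoped, so that each term contains one difference of kernels. -/
lemma exists_greenProd_sub_bound {L : ℝ} (hL : 0 < L) (M k : ℕ) {η : ℝ → ℂ}
    (hη : IsAmplitude L η) : ∃ C : ℝ, ∀ rs : List ℝ, rs.length = k + 1 →
      (∀ r ∈ rs, 0 < r) → ∀ t : ℝ, t ≠ 0 →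
      ‖schrodingerIntegral L t (fun s => s * η s *
        (greenProd (2 * M + 3) (rs.map fun r => (1, r)) s
          - greenProd (2 * M + 3) (rs.map fun r => (-1, r)) s))‖
      ≤ C * (|t| ^ (-(1 / 2) : ℝ) * |t|⁻¹ ^ (M + 1)) * majorantWeight M rs := by
  obtain ⟨κ, hκ⟩ := exists_freeGreen_sub_eq M
  have hprof := isProfile_poissonProfile hL M _ dvd_rfl
  set F := poissonProfile ((1 - Polynomial.X ^ 2) ^ M) with hF
  obtain ⟨C, hC0, hC⟩ := exists_profile_greenProd_bound M hprof k η hη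
  have hFc := hprof.continuous
  have hηc := hη.continuous
  suffices H : ∀ (rs : List ℝ) (P : List (ℝ × ℝ)), P.length + rs.length = k + 1 →
      (∀ p ∈ P, |p.1| = 1 ∧ 0 < p.2) → (∀ r ∈ rs, 0 < r) → ∀ t : ℝ, t ≠ 0 →
      ‖schrodingerIntegral L t (fun s => s * η s * (greenProd (2 * M + 3) P s *
        (greenProd (2 * M + 3) (rs.map fun r => (1, r)) s
          - greenProd (2 * M + 3) (rs.map fun r => (-1, r)) s)))‖
      ≤ rs.length * (‖κ‖ * C) * (|t| ^ (-(1 / 2) : ℝ) * |t|⁻¹ ^ (M + 1))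
        * majorantWeight M (P.map Prod.snd ++ rs) by
    refine ⟨(k + 1 : ℕ) * (‖κ‖ * C), fun rs hlen hrs t ht => ?_⟩
    have := H rs [] (by simpa using hlen) (by simp) hrs t ht
    simpa [greenProd, hlen] using this
  intro rs
  induction rs with
  | nil =>
    intro P _ _ _ t _
    simp [schrodingerIntegral, greenProd]
  | cons r rs ih =>
    intro P hlen hP hrs t ht
    have hr : 0 < r := hrs r (by simp)
    have hrs' : ∀ x ∈ rs, 0 < x := fun x hx => hrs x (by simp [hx])
    set Q : List (ℝ × ℝ) := P ++ rs.map fun r => (1, r) with hQ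
    have hQlen : Q.length = k := by simp [hQ] at hlen ⊢; omega
    have hQpos : ∀ p ∈ Q, |p.1| = 1 ∧ 0 < p.2 := by
      intro p hp
      rcases List.mem_append.1 hp with hp | hp
      · exact hP p hp
      · obtain ⟨x, hx, rfl⟩ := List.mem_map.1 hp
        exact ⟨abs_one, hrs' x hx⟩
    have hQmap : Q.map Prod.snd = P.map Prod.snd ++ rs := by
      simp [hQ, Function.comp_def]
    have hperm : (P.map Prod.snd ++ r :: rs).Perm (r :: Q.map Prod.snd) := by
      rw [hQmap]; exact List.perm_middle
    have h1 := hC Q hQlen hQpos t ht 0 r hr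
    have h2 := ih ((-1, r) :: P) (by simp at hlen ⊢; omega)
      (by
        intro p hp
        rcases List.mem_cons.1 hp with rfl | hp
        · simpa using hr
        · exact hP p hp) hrs' t ht
    have hperm2 : (((-1, r) :: P).map Prod.snd ++ rs).Perm (P.map Prod.snd ++ r :: rs) := by
      simpa using List.perm_middle.symm
    rw [majorantWeight_perm M hperm2] at h2
    have hw : (1 + (|(0 : ℝ)| / max 1 r) ^ (M + 1)) * majorantProd M (Q.map Prod.snd)
          + greenMajorant M r * majorantWeight M (Q.map Prod.snd)
        = majorantWeight M (P.map Prod.snd ++ r :: rs) := by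
      rw [majorantWeight_perm M hperm, majorantWeight]
      simp; ring
    rw [hw] at h1
    set w := majorantWeight M (P.map Prod.snd ++ r :: rs)
    set T := |t| ^ (-(1 / 2) : ℝ) * |t|⁻¹ ^ (M + 1)
    have c1 := continuous_greenProd (2 * M + 3) P
    have c2 := continuous_greenProd (2 * M + 3) Q
    have c3 := continuous_greenProd (2 * M + 3) (rs.map fun r => (1, r))
    have c4 := continuous_greenProd (2 * M + 3) (rs.map fun r => (-1, r))
    have c5 := continuous_greenProd (2 * M + 3) ((-1, r) :: P)
    -- replace the sign of the step `r` first: the difference is a profile times `s ^ (2M + 1)`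
    have hsplit : (fun s : ℝ => (s : ℂ) * η s * (greenProd (2 * M + 3) P s *
        (greenProd (2 * M + 3) ((r :: rs).map fun r => (1, r)) s
          - greenProd (2 * M + 3) ((r :: rs).map fun r => (-1, r)) s)))
        = fun s : ℝ => κ * ((s : ℂ) ^ (2 * (M + 1)) *
          (η s * Complex.exp (Complex.I * (0 : ℝ) * s) * F (s * r)) * greenProd (2 * M + 3) Q s)
          + s * η s * (greenProd (2 * M + 3) ((-1, r) :: P) s *
            (greenProd (2 * M + 3) (rs.map fun r => (1, r)) s
              - greenProd (2 * M + 3) (rs.map fun r => (-1, r)) s)) := by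
      ext s
      have hk := hκ s r hr
      simp only [List.map_cons, greenProd_cons, hQ, greenProd_append, one_mul, neg_mul]
      simp only [Complex.ofReal_zero, mul_zero, zero_mul, Complex.exp_zero, mul_one]
      linear_combination ((s : ℂ) * η s * greenProd (2 * M + 3) P s
        * greenProd (2 * M + 3) (rs.map fun r => (1, r)) s) * hk
    rw [hsplit, schrodingerIntegral_add (by fun_prop) (by fun_prop),
      schrodingerIntegral_const_mul]
    calc _ ≤ ‖κ‖ * (C * T * w) + rs.length * (‖κ‖ * C) * T * w := by
          refine (norm_add_le _ _).trans (add_le_add ?_ h2)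
          rw [norm_mul]; gcongr
      _ = _ := by simp; ring

/-! ### Pointwise bounds for the free resolvent kernel -/

lemma exists_freeGreen_bound (M : ℕ) (L : ℝ) : ∃ C : ℝ, 0 ≤ C ∧ ∀ lam r : ℝ, |lam| ≤ L → 0 ≤ r →
    ‖freeGreen (2 * M + 3) lam r‖ ≤ C * greenMajorant M r := by
  refine ⟨‖greenConst M‖ * ∑ q ∈ Finset.range (M + 1), ‖(greenPoly M).coeff q‖ * |L| ^ q,
    by positivity, fun lam r hlam hr => ?_⟩
  rcases hr.eq_or_lt with rfl | hr
  -- at `r = 0` both sides vanish, as division by zero gives `0`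
  · simp [freeGreen_eq, greenMajorant]
  have hdeg : (greenPoly M).natDegree < M + 1 := by
    rw [Nat.lt_succ_iff, Polynomial.natDegree_le_iff_coeff_eq_zero]
    intro q hq
    rw [coeff_greenPoly, if_neg (by omega)]
  rw [freeGreen_eq, Polynomial.eval_eq_sum_range' hdeg, norm_mul, norm_mul, norm_div,
    norm_cexp_I_mul_mul, mul_assoc, mul_assoc]
  refine mul_le_mul_of_nonneg_left ?_ (norm_nonneg _)
  rw [Finset.sum_mul]
  refine (mul_le_mul_of_nonneg_left (norm_sum_le _ _) (by positivity)).trans ?_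
  rw [Finset.mul_sum]
  refine Finset.sum_le_sum fun q hq => ?_
  have h1 := pow_mul_inv_le_greenMajorant (Nat.lt_succ_iff.1 (Finset.mem_range.1 hq)) hr
  have h2 : |lam| ^ q ≤ |L| ^ q := by exact pow_le_pow_left₀ (abs_nonneg _) (hlam.trans (le_abs_self L)) q
  simp only [norm_mul, norm_pow, Complex.norm_real, Real.norm_eq_abs, abs_of_pos hr]
  calc _ = ‖(greenPoly M).coeff q‖ * |lam| ^ q * (r ^ q * (r ^ (2 * M + 1))⁻¹) := by
        rw [mul_pow]; ring
    _ ≤ _ := by gcongr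

/-- The quasi-metric property of the majorant: of two consecutive steps, one is at least half as
long as the straight line. -/
lemma greenMajorant_mul_le (M : ℕ) {a b c : ℝ} (ha : 0 ≤ a) (hb : 0 ≤ b) (hc : 0 < c)
    (h : c ≤ a + b) : greenMajorant M a * greenMajorant M b
      ≤ 2 ^ (2 * M + 1) * greenMajorant M c * (greenMajorant M a + greenMajorant M b) := by
  have hKa := greenMajorant_nonneg M ha
  have hKb := greenMajorant_nonneg M hb
  have hKc := greenMajorant_nonneg M hc.le
  have key : ∀ x : ℝ, c / 2 ≤ x → greenMajorant M x ≤ 2 ^ (2 * M + 1) * greenMajorant M c := by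
    intro x hx
    have e1 : (x ^ (2 * M + 1))⁻¹ ≤ 2 ^ (2 * M + 1) * (c ^ (2 * M + 1))⁻¹ := by
      calc (x ^ (2 * M + 1))⁻¹ ≤ ((c / 2) ^ (2 * M + 1))⁻¹ := by gcongr
        _ = _ := by rw [div_pow, inv_div, div_eq_mul_inv]
    have e2 : (x ^ (M + 1))⁻¹ ≤ 2 ^ (2 * M + 1) * (c ^ (M + 1))⁻¹ := by
      calc (x ^ (M + 1))⁻¹ ≤ ((c / 2) ^ (M + 1))⁻¹ := by gcongr
        _ = 2 ^ (M + 1) * (c ^ (M + 1))⁻¹ := by rw [div_pow, inv_div, div_eq_mul_inv]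
        _ ≤ _ := by
          gcongr
          · norm_num
          · omega
    unfold greenMajorant
    linarith
  set D := 2 ^ (2 * M + 1) * greenMajorant M c with hD
  have hD0 : 0 ≤ D := by positivity
  rcases le_total (c / 2) a with h1 | h1
  · have := mul_le_mul_of_nonneg_right (key a h1) hKb
    nlinarith [mul_nonneg hD0 hKa]
  · have := mul_le_mul_of_nonneg_left (key b (by linarith)) hKa
    nlinarith [mul_nonneg hD0 hKb]

section
variable {M : ℕ}

/-! ### Uniform bounds for the potential -/

/-- The Newtonian singularity is locally integrable. -/
lemma integrable_indicator_singularity (M : ℕ) :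
    Integrable (fun w : EuclideanSpace ℝ (Fin (2 * M + 3)) =>
      (Iio (1 : ℝ)).indicator (fun r => (r ^ (2 * M + 1))⁻¹) ‖w‖) := by
  rw [integrable_fun_norm_addHaar volume
    (f := (Iio (1 : ℝ)).indicator (fun r : ℝ => (r ^ (2 * M + 1))⁻¹))]
  have h : IntegrableOn (fun r : ℝ => r) (Ioo 0 1) :=
    (continuous_id.integrableOn_Icc (a := 0) (b := 1)).mono_set Ioo_subset_Icc_self
  have h2 : Integrable ((Ioo (0 : ℝ) 1).indicator fun r : ℝ => r) :=
    (integrable_indicator_iff measurableSet_Ioo).2 h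
  refine h2.integrableOn.congr_fun (s := Ioi 0) ?_ measurableSet_Ioi
  intro r (hr : 0 < r)
  by_cases h1 : r < 1
  · simp only [indicator, mem_Ioo, hr, h1, and_self, if_true, mem_Iio, finrank_euclideanSpace,
      Fintype.card_fin, smul_eq_mul]
    rw [show 2 * M + 3 - 1 = 2 * M + 1 + 1 by omega, pow_succ]
    field_simp
  · simp [indicator, h1]

lemma rpow_mul_rpow_le_add {a b p q : ℝ} (ha : 0 < a) (hb : 0 < b) (hp : 0 ≤ p) (hq : 0 ≤ q) :
    a ^ (-p) * b ^ (-q) ≤ a ^ (-(p + q)) + b ^ (-(p + q)) := by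
  have ha' : 0 ≤ a ^ (-(p + q)) := Real.rpow_nonneg ha.le _
  have hb' : 0 ≤ b ^ (-(p + q)) := Real.rpow_nonneg hb.le _
  have hap : 0 ≤ a ^ (-p) := Real.rpow_nonneg ha.le _
  have hbq : 0 ≤ b ^ (-q) := Real.rpow_nonneg hb.le _
  rcases le_total a b with h | h
  · have : b ^ (-q) ≤ a ^ (-q) := Real.rpow_le_rpow_of_nonpos ha h (by linarith)
    calc _ ≤ a ^ (-p) * a ^ (-q) := by gcongr
      _ = a ^ (-(p + q)) := by rw [← Real.rpow_add ha]; congr 1; ring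
      _ ≤ _ := by linarith
  · have : a ^ (-p) ≤ b ^ (-p) := Real.rpow_le_rpow_of_nonpos hb h (by linarith)
    calc _ ≤ b ^ (-p) * b ^ (-q) := by gcongr
      _ = b ^ (-(p + q)) := by rw [← Real.rpow_add hb]; congr 1; ring
      _ ≤ _ := by linarith

lemma measurable_greenMajorant (M : ℕ) : Measurable (greenMajorant M) := by
  unfold greenMajorant; fun_prop

/-- The operator with kernel `|V(z)| K(|z - y|)` is bounded uniformly in `y`: near `y` the
singularity is integrable, far away the decay of the potential and of the majorant together beat
the dimension. -/
lemma exists_potential_bound {V : EuclideanSpace ℝ (Fin (2 * M + 3)) → ℝ} (hVmeas : Measurable V)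
    {A ε : ℝ} (hε : 0 < ε) (hV : ∀ x, |V x| ≤ A * (1 + ‖x‖) ^ (-((M : ℝ) + 3 + ε))) :
    ∃ S : ℝ, ∀ y, Integrable (fun z => |V z| * greenMajorant M ‖z - y‖) ∧
      ∫ z, |V z| * greenMajorant M ‖z - y‖ ≤ S := by
  have hA : 0 ≤ A := by
    have := (abs_nonneg _).trans (hV 0)
    simpa using this
  set q : ℝ := (M + 3 + ε) + (M + 1) with hq
  set f₁ : EuclideanSpace ℝ (Fin (2 * M + 3)) → ℝ := fun w => (Iio (1 : ℝ)).indicator (fun r => (r ^ (2 * M + 1))⁻¹) ‖w‖ with hf₁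
  set f₂ : EuclideanSpace ℝ (Fin (2 * M + 3)) → ℝ := fun w => (1 + ‖w‖) ^ (-q) with hf₂
  have hi₁ : Integrable f₁ := integrable_indicator_singularity M
  have hi₂ : Integrable f₂ := integrable_one_add_norm (by
    rw [finrank_euclideanSpace, Fintype.card_fin, hq]; push_cast; linarith)
  have hf₁0 : ∀ w, 0 ≤ f₁ w := fun w => by
    simp only [hf₁, indicator_apply]
    split_ifs <;> positivity
  have hf₂0 : ∀ w, 0 ≤ f₂ w := fun w => by positivity
  have hbound : ∀ y z : EuclideanSpace ℝ (Fin (2 * M + 3)), |V z| * greenMajorant M ‖z - y‖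
      ≤ A * (2 * f₁ (z - y) + 2 ^ (M + 2) * (f₂ z + f₂ (z - y))) := by
    intro y z
    set w := ‖z - y‖ with hw
    have hw0 : 0 ≤ w := norm_nonneg _
    have hz1 : 1 ≤ 1 + ‖z‖ := by linarith [norm_nonneg z]
    have hKw := greenMajorant_nonneg M hw0
    rcases lt_or_ge w 1 with h | h
    · have hVA : |V z| ≤ A := (hV z).trans (mul_le_of_le_one_right hA
        (Real.rpow_le_one_of_one_le_of_nonpos hz1 (by linarith [(Nat.cast_nonneg M : (0:ℝ) ≤ M)])))
      have hf : f₁ (z - y) = (w ^ (2 * M + 1))⁻¹ := by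
        simp only [hf₁]; rw [← hw]; simp [indicator, h]
      have hK : greenMajorant M w ≤ 2 * f₁ (z - y) := by
        rw [hf]
        rcases hw0.eq_or_lt with h0 | h0
        -- the majorant takes the value `0⁻¹ + 0⁻¹ = 0` at `w = 0`
        · rw [← h0]; simp [greenMajorant]
        · have : w ^ (2 * M + 1) ≤ w ^ (M + 1) := pow_le_pow_of_le_one hw0 h.le (by omega)
          have : (w ^ (M + 1))⁻¹ ≤ (w ^ (2 * M + 1))⁻¹ := by gcongr
          unfold greenMajorant; linarith
      calc _ ≤ A * (2 * f₁ (z - y)) := by gcongr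
        _ ≤ _ := by
          gcongr
          have := hf₂0 z
          have := hf₂0 (z - y)
          have : 0 ≤ (2 : ℝ) ^ (M + 2) * (f₂ z + f₂ (z - y)) := by positivity
          linarith
    · have hw1 : 0 < w := by linarith
      have hK : greenMajorant M w ≤ 2 ^ (M + 2) * (1 + w) ^ (-((M : ℝ) + 1)) := by
        have e1 : w ^ (M + 1) ≤ w ^ (2 * M + 1) := pow_le_pow_right₀ h (by omega)
        have e2 : (w ^ (2 * M + 1))⁻¹ ≤ (w ^ (M + 1))⁻¹ := by gcongr
        have e3 : (w ^ (M + 1))⁻¹ ≤ 2 ^ (M + 1) * ((1 + w) ^ (M + 1))⁻¹ := by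
          calc (w ^ (M + 1))⁻¹ ≤ (((1 + w) / 2) ^ (M + 1))⁻¹ := by gcongr; linarith
            _ = _ := by rw [div_pow, inv_div, div_eq_mul_inv]
        have e4 : (1 + w) ^ (-((M : ℝ) + 1)) = ((1 + w) ^ (M + 1))⁻¹ := by
          rw [Real.rpow_neg (by linarith)]
          congr 1
          exact_mod_cast Real.rpow_natCast (1 + w) (M + 1)
        rw [e4, pow_succ' 2 (M + 1)]
        unfold greenMajorant; linarith
      calc _ ≤ (A * (1 + ‖z‖) ^ (-((M : ℝ) + 3 + ε)))
            * (2 ^ (M + 2) * (1 + w) ^ (-((M : ℝ) + 1))) := by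
            gcongr
            exact hV z
        _ = A * (2 ^ (M + 2) * ((1 + ‖z‖) ^ (-((M : ℝ) + 3 + ε)) * (1 + w) ^ (-((M : ℝ) + 1)))) := by
            ring
        _ ≤ A * (2 ^ (M + 2) * (f₂ z + f₂ (z - y))) := by
            gcongr
            exact rpow_mul_rpow_le_add (by linarith) (by linarith) (by positivity) (by positivity)
        _ ≤ _ := by
            gcongr
            have := hf₁0 (z - y)
            linarith
  have hint : ∀ y, Integrable fun z => A * (2 * f₁ (z - y) + 2 ^ (M + 2) * (f₂ z + f₂ (z - y))) :=
    fun y => (((hi₁.comp_sub_right y).const_mul 2).add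
      ((hi₂.add (hi₂.comp_sub_right y)).const_mul _)).const_mul A
  refine ⟨A * (2 * (∫ w, f₁ w) + 2 ^ (M + 2) * ((∫ w, f₂ w) + ∫ w, f₂ w)), fun y => ?_⟩
  have hI : Integrable (fun z => |V z| * greenMajorant M ‖z - y‖) := by
    refine (hint y).mono' ?_ (ae_of_all _ fun z => ?_)
    · have := measurable_greenMajorant M
      exact Measurable.aestronglyMeasurable (by fun_prop)
    · rw [Real.norm_eq_abs, abs_of_nonneg (mul_nonneg (abs_nonneg _)
        (greenMajorant_nonneg M (norm_nonneg _)))]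
      exact hbound y z
  refine ⟨hI, (integral_mono hI (hint y) (hbound y)).trans (le_of_eq ?_)⟩
  have hi₃ : Integrable (fun z => 2 ^ (M + 2) * (f₂ z + f₂ (z - y))) :=
    (hi₂.add (hi₂.comp_sub_right y)).const_mul _
  rw [integral_const_mul, integral_add ((hi₁.comp_sub_right y).const_mul 2) hi₃,
    integral_const_mul, integral_const_mul,
    integral_add hi₂ (hi₂.comp_sub_right y), integral_sub_right_eq_self f₁ y,
    integral_sub_right_eq_self f₂ y]

/-! ### The kernels of the Born series -/

lemma measurable_freeGreen (n : ℕ) : Measurable fun p : ℝ × ℝ => freeGreen n p.1 p.2 := by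
  unfold freeGreen; fun_prop

lemma stronglyMeasurable_bornKernel {n : ℕ} {V : EuclideanSpace ℝ (Fin n) → ℝ}
    (hV : Measurable V) (k : ℕ) : StronglyMeasurable
      fun p : ℝ × EuclideanSpace ℝ (Fin n) × EuclideanSpace ℝ (Fin n) =>
        bornKernel V p.1 k p.2.1 p.2.2 := by
  induction k with
  | zero =>
    have h : Measurable fun p : ℝ × EuclideanSpace ℝ (Fin n) × EuclideanSpace ℝ (Fin n) =>
        freeGreen n p.1 ‖p.2.1 - p.2.2‖ := (measurable_freeGreen n).comp
      (f := fun p : ℝ × EuclideanSpace ℝ (Fin n) × EuclideanSpace ℝ (Fin n) =>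
        (p.1, ‖p.2.1 - p.2.2‖))
      (measurable_fst.prodMk (measurable_snd.fst.sub measurable_snd.snd).norm)
    exact h.stronglyMeasurable
  | succ k ih =>
    have h1 : Measurable fun q : (ℝ × EuclideanSpace ℝ (Fin n) × EuclideanSpace ℝ (Fin n))
        × EuclideanSpace ℝ (Fin n) => bornKernel V q.1.1 k q.1.2.1 q.2 :=
      ih.measurable.comp
        (f := fun q : (ℝ × EuclideanSpace ℝ (Fin n) × EuclideanSpace ℝ (Fin n))
          × EuclideanSpace ℝ (Fin n) => (q.1.1, q.1.2.1, q.2))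
        (measurable_fst.fst.prodMk (measurable_fst.snd.fst.prodMk measurable_snd))
    have h2 : Measurable fun q : (ℝ × EuclideanSpace ℝ (Fin n) × EuclideanSpace ℝ (Fin n))
        × EuclideanSpace ℝ (Fin n) => freeGreen n q.1.1 ‖q.2 - q.1.2.2‖ :=
      (measurable_freeGreen n).comp
        (f := fun q : (ℝ × EuclideanSpace ℝ (Fin n) × EuclideanSpace ℝ (Fin n))
          × EuclideanSpace ℝ (Fin n) => (q.1.1, ‖q.2 - q.1.2.2‖))
        (measurable_fst.fst.prodMk (measurable_snd.sub measurable_fst.snd.snd).norm)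
    have h3 : Measurable fun q : (ℝ × EuclideanSpace ℝ (Fin n) × EuclideanSpace ℝ (Fin n))
        × EuclideanSpace ℝ (Fin n) => ((V q.2 : ℝ) : ℂ) :=
      Complex.measurable_ofReal.comp (hV.comp measurable_snd)
    have h4 : StronglyMeasurable fun q : (ℝ × EuclideanSpace ℝ (Fin n) × EuclideanSpace ℝ (Fin n))
        × EuclideanSpace ℝ (Fin n) => bornKernel V q.1.1 k q.1.2.1 q.2 * ((V q.2 : ℝ) : ℂ)
          * freeGreen n q.1.1 ‖q.2 - q.1.2.2‖ := ((h1.mul h3).mul h2).stronglyMeasurable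
    exact h4.integral_prod_right' (ν := volume)

end

section
variable {M : ℕ} {V : EuclideanSpace ℝ (Fin (2 * M + 3)) → ℝ}

lemma integral_majorant_comp {S : ℝ} (hVmeas : Measurable V)
    (hS : ∀ y, Integrable (fun z => |V z| * greenMajorant M ‖z - y‖) ∧
      ∫ z, |V z| * greenMajorant M ‖z - y‖ ≤ S)
    {x y : EuclideanSpace ℝ (Fin (2 * M + 3))} (hxy : x ≠ y) :
    Integrable (fun z => |V z| * (greenMajorant M ‖x - z‖ * greenMajorant M ‖z - y‖)) ∧
      ∫ z, |V z| * (greenMajorant M ‖x - z‖ * greenMajorant M ‖z - y‖)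
        ≤ 2 ^ (2 * M + 1) * (2 * S) * greenMajorant M ‖x - y‖ := by
  set D := 2 ^ (2 * M + 1) * greenMajorant M ‖x - y‖ with hD
  have hK0 : ∀ u : EuclideanSpace ℝ (Fin (2 * M + 3)), 0 ≤ greenMajorant M ‖u‖ :=
    fun u => greenMajorant_nonneg M (norm_nonneg u)
  have hD0 : 0 ≤ D := mul_nonneg (by positivity) (hK0 _)
  have hb : ∀ z, |V z| * (greenMajorant M ‖x - z‖ * greenMajorant M ‖z - y‖)
      ≤ D * (|V z| * greenMajorant M ‖z - x‖ + |V z| * greenMajorant M ‖z - y‖) := by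
    intro z
    have h := greenMajorant_mul_le M (norm_nonneg (x - z)) (norm_nonneg (z - y))
      (norm_pos_iff.2 (sub_ne_zero.2 hxy)) (norm_sub_le_norm_sub_add_norm_sub x z y)
    rw [norm_sub_rev z x]
    calc _ ≤ |V z| * (D * (greenMajorant M ‖x - z‖ + greenMajorant M ‖z - y‖)) := by gcongr
      _ = _ := by ring
  have hint : Integrable fun z =>
      D * (|V z| * greenMajorant M ‖z - x‖ + |V z| * greenMajorant M ‖z - y‖) :=
    ((hS x).1.add (hS y).1).const_mul D
  have hI : Integrable fun z =>
      |V z| * (greenMajorant M ‖x - z‖ * greenMajorant M ‖z - y‖) := by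
    refine hint.mono' ?_ (ae_of_all _ fun z => ?_)
    · have := measurable_greenMajorant M
      exact Measurable.aestronglyMeasurable (by fun_prop)
    · rw [Real.norm_eq_abs, abs_of_nonneg (mul_nonneg (abs_nonneg _)
        (mul_nonneg (hK0 _) (hK0 _)))]
      exact hb z
  refine ⟨hI, (integral_mono hI hint hb).trans ?_⟩
  rw [integral_const_mul, integral_add (hS x).1 (hS y).1]
  calc _ ≤ D * (S + S) := by gcongr; exacts [(hS x).2, (hS y).2]
    _ = _ := by rw [hD]; ring

lemma norm_compIntegrand_le {L G C lam : ℝ} (hlam : |lam| ≤ L)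
    (hG : ∀ lam r : ℝ, |lam| ≤ L → 0 ≤ r →
      ‖freeGreen (2 * M + 3) lam r‖ ≤ G * greenMajorant M r)
    {k : ℕ} {x y z : EuclideanSpace ℝ (Fin (2 * M + 3))}
    (hC : ‖bornKernel V lam k x z‖ ≤ C * greenMajorant M ‖x - z‖) :
    ‖compIntegrand V (bornKernel V lam k) (freeResolvent lam) x y z‖
      ≤ C * G * (|V z| * (greenMajorant M ‖x - z‖ * greenMajorant M ‖z - y‖)) := by
  have h2 := hG lam ‖z - y‖ hlam (norm_nonneg _)
  have hK := greenMajorant_nonneg M (norm_nonneg (x - z))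
  have hK' := greenMajorant_nonneg M (norm_nonneg (z - y))
  unfold compIntegrand freeResolvent
  rw [norm_mul, norm_mul, Complex.norm_real, Real.norm_eq_abs]
  calc _ ≤ (C * greenMajorant M ‖x - z‖) * |V z| * (G * greenMajorant M ‖z - y‖) := by
        refine mul_le_mul ?_ h2 (norm_nonneg _) ?_
        · gcongr
        · exact mul_nonneg ((norm_nonneg _).trans hC) (abs_nonneg _)
    _ = _ := by ring

lemma measurable_bornKernel_left {n : ℕ} {V : EuclideanSpace ℝ (Fin n) → ℝ}
    (hV : Measurable V) (k : ℕ) (x y : EuclideanSpace ℝ (Fin n)) :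
    Measurable fun lam => bornKernel V lam k x y :=
  (stronglyMeasurable_bornKernel hV k).measurable.comp
    (f := fun lam : ℝ => (lam, x, y)) (by fun_prop)

lemma measurable_compIntegrand {n : ℕ} {V : EuclideanSpace ℝ (Fin n) → ℝ} (hV : Measurable V)
    (k : ℕ) (x y : EuclideanSpace ℝ (Fin n)) :
    Measurable fun p : ℝ × EuclideanSpace ℝ (Fin n) =>
      compIntegrand V (bornKernel V p.1 k) (freeResolvent p.1) x y p.2 := by
  have h1 : Measurable fun p : ℝ × EuclideanSpace ℝ (Fin n) => bornKernel V p.1 k x p.2 :=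
    (stronglyMeasurable_bornKernel hV k).measurable.comp
      (f := fun p : ℝ × EuclideanSpace ℝ (Fin n) => (p.1, x, p.2)) (by fun_prop)
  have h2 : Measurable fun p : ℝ × EuclideanSpace ℝ (Fin n) => freeGreen n p.1 ‖p.2 - y‖ :=
    (measurable_freeGreen n).comp
      (f := fun p : ℝ × EuclideanSpace ℝ (Fin n) => (p.1, ‖p.2 - y‖)) (by fun_prop)
  have h3 : Measurable fun p : ℝ × EuclideanSpace ℝ (Fin n) => ((V p.2 : ℝ) : ℂ) :=
    Complex.measurable_ofReal.comp (hV.comp measurable_snd)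
  exact (h1.mul h3).mul h2

/-- The iterated kernels are dominated by the majorant, locally uniformly in the energy. -/
lemma exists_bornKernel_bound {S : ℝ} (hVmeas : Measurable V)
    (hS : ∀ y, Integrable (fun z => |V z| * greenMajorant M ‖z - y‖) ∧
      ∫ z, |V z| * greenMajorant M ‖z - y‖ ≤ S) (L : ℝ) (k : ℕ) :
    ∃ C : ℝ, 0 ≤ C ∧ ∀ (lam : ℝ) (x y : EuclideanSpace ℝ (Fin (2 * M + 3))), |lam| ≤ L → x ≠ y →
      ‖bornKernel V lam k x y‖ ≤ C * greenMajorant M ‖x - y‖ := by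
  obtain ⟨G, hG0, hG⟩ := exists_freeGreen_bound M L
  have hS0 : 0 ≤ S := (integral_nonneg fun z => mul_nonneg (abs_nonneg _)
    (greenMajorant_nonneg M (norm_nonneg _))).trans (hS 0).2
  induction k with
  | zero => exact ⟨G, hG0, fun lam x y hlam _ => hG lam _ hlam (norm_nonneg _)⟩
  | succ k ih =>
    obtain ⟨C, hC0, hC⟩ := ih
    refine ⟨C * G * (2 ^ (2 * M + 1) * (2 * S)), by positivity, fun lam x y hlam hxy => ?_⟩
    obtain ⟨hI, hle⟩ := integral_majorant_comp hVmeas hS hxy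
    simp only [bornKernel]
    calc _ ≤ ∫ z, C * G * (|V z| * (greenMajorant M ‖x - z‖ * greenMajorant M ‖z - y‖)) := by
          refine norm_integral_le_of_norm_le (hI.const_mul _) ?_
          filter_upwards [Measure.ae_ne volume x] with z hz
          exact norm_compIntegrand_le hlam hG (hC lam x z hlam hz.symm)
      _ ≤ C * G * (2 ^ (2 * M + 1) * (2 * S) * greenMajorant M ‖x - y‖) := by
          rw [integral_const_mul]; gcongr
      _ = _ := by ring

lemma integrable_compIntegrand {S : ℝ} (hVmeas : Measurable V)
    (hS : ∀ y, Integrable (fun z => |V z| * greenMajorant M ‖z - y‖) ∧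
      ∫ z, |V z| * greenMajorant M ‖z - y‖ ≤ S) (k : ℕ) (lam : ℝ)
    {x y : EuclideanSpace ℝ (Fin (2 * M + 3))} (hxy : x ≠ y) :
    Integrable (compIntegrand V (bornKernel V lam k) (freeResolvent lam) x y) := by
  obtain ⟨G, hG0, hG⟩ := exists_freeGreen_bound M |lam|
  obtain ⟨C, -, hC⟩ := exists_bornKernel_bound hVmeas hS |lam| k
  refine ((integral_majorant_comp hVmeas hS hxy).1.const_mul (C * G)).mono' ?_ ?_
  · exact ((measurable_compIntegrand hVmeas k x y).comp
      (f := fun z => (lam, z)) (by fun_prop)).aestronglyMeasurable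
  · filter_upwards [Measure.ae_ne volume x] with z hz
    exact norm_compIntegrand_le le_rfl hG (hC lam x z le_rfl hz.symm)

/-! ### Integrating out the intermediate points -/

/-- The reduction to fixed intermediate points. If the `λ`-integral of `Φ` against every product of
`k + 1` free kernels is bounded by `a` times the product of all majorants plus `b` times the sum of
the products with one factor omitted, then integrating out the intermediate points gives
`a K(|x - y|) + b`, up to a constant. The last step `r` of the path is absorbed in `Φ`, which
replaces `(a, b)` by `(a K(r) + b, b K(r))`. -/
lemma exists_born_integral_bound {S : ℝ} (hVmeas : Measurable V)
    (hS : ∀ y, Integrable (fun z => |V z| * greenMajorant M ‖z - y‖) ∧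
      ∫ z, |V z| * greenMajorant M ‖z - y‖ ≤ S) {L : ℝ}
    {μ : Measure ℝ} [IsFiniteMeasure μ] (hμ : ∀ᵐ s ∂μ, |s| ≤ L) (k : ℕ) :
    ∃ C : ℝ, 0 ≤ C ∧ ∀ Φ : ℝ → ℂ, Measurable Φ → (∃ B, ∀ s, |s| ≤ L → ‖Φ s‖ ≤ B) →
      ∀ a b : ℝ, 0 ≤ a → 0 ≤ b →
      (∀ rs : List ℝ, rs.length = k + 1 → (∀ r ∈ rs, 0 < r) →
        ‖∫ s, Φ s * greenProd (2 * M + 3) (rs.map fun r => (1, r)) s ∂μ‖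
          ≤ a * majorantProd M rs + b * majorantWeight M rs) →
      ∀ x y : EuclideanSpace ℝ (Fin (2 * M + 3)), x ≠ y →
        ‖∫ s, Φ s * bornKernel V s k x y ∂μ‖ ≤ C * (a * greenMajorant M ‖x - y‖ + b) := by
  obtain ⟨G, hG0, hG⟩ := exists_freeGreen_bound M L
  have hS0 : 0 ≤ S := (integral_nonneg fun z => mul_nonneg (abs_nonneg _)
    (greenMajorant_nonneg M (norm_nonneg _))).trans (hS 0).2
  induction k with
  | zero =>
    refine ⟨1, zero_le_one, fun Φ _ _ a b _ _ h x y hxy => ?_⟩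
    have hr : 0 < ‖x - y‖ := norm_pos_iff.2 (sub_ne_zero.2 hxy)
    have := h [‖x - y‖] rfl (by simpa using hr)
    simpa [greenProd, majorantProd, majorantWeight, bornKernel, freeResolvent] using this
  | succ k ih =>
    obtain ⟨C, hC0, hC⟩ := ih
    obtain ⟨D, hD0, hD⟩ := exists_bornKernel_bound hVmeas hS L k
    set T : ℝ := 2 ^ (2 * M + 1) * (2 * S) with hT
    refine ⟨C * (T + 2 * S), by positivity, fun Φ hΦ ⟨B, hB⟩ a b ha hb h x y hxy => ?_⟩
    obtain ⟨hI, hle⟩ := integral_majorant_comp hVmeas hS hxy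
    have hmeas := measurable_compIntegrand hVmeas k x y
    have hFub : Integrable (Function.uncurry fun (s : ℝ) z =>
        Φ s * compIntegrand V (bornKernel V s k) (freeResolvent s) x y z) (μ.prod volume) := by
      have hdom := (integrable_const (μ := μ) B).mul_prod (hI.const_mul (D * G))
      refine hdom.mono' ((hΦ.comp measurable_fst).mul hmeas).aestronglyMeasurable ?_
      filter_upwards [Measure.quasiMeasurePreserving_fst.ae hμ,
        Measure.quasiMeasurePreserving_snd.ae (Measure.ae_ne volume x)] with p hp1 hp2
      simp only [Function.uncurry]
      rw [norm_mul]
      refine mul_le_mul (hB _ hp1) ?_ (norm_nonneg _) ((norm_nonneg _).trans (hB _ hp1))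
      exact norm_compIntegrand_le hp1 hG (hD _ x p.2 hp1 hp2.symm)
    have hswap : ∫ s, Φ s * bornKernel V s (k + 1) x y ∂μ
        = ∫ z, ∫ s, Φ s * compIntegrand V (bornKernel V s k) (freeResolvent s) x y z ∂μ := by
      simp only [bornKernel]
      rw [← integral_integral_swap hFub]
      simp_rw [integral_const_mul]
    have hdom : Integrable fun z =>
        C * (a * (|V z| * (greenMajorant M ‖x - z‖ * greenMajorant M ‖z - y‖))
          + (b * (|V z| * greenMajorant M ‖z - x‖) + b * (|V z| * greenMajorant M ‖z - y‖))) :=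
      ((hI.const_mul a).add (((hS x).1.const_mul b).add ((hS y).1.const_mul b))).const_mul C
    have hpt : ∀ᵐ z, ‖∫ s, Φ s * compIntegrand V (bornKernel V s k) (freeResolvent s) x y z ∂μ‖
        ≤ C * (a * (|V z| * (greenMajorant M ‖x - z‖ * greenMajorant M ‖z - y‖))
          + (b * (|V z| * greenMajorant M ‖z - x‖) + b * (|V z| * greenMajorant M ‖z - y‖))) := by
      filter_upwards [Measure.ae_ne volume x, Measure.ae_ne volume y] with z hzx hzy
      have hr : 0 < ‖z - y‖ := norm_pos_iff.2 (sub_ne_zero.2 hzy)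
      have hK := greenMajorant_nonneg M hr.le
      set r := ‖z - y‖ with hrdef
      have hGm : Measurable fun s : ℝ => freeGreen (2 * M + 3) s r :=
        (measurable_freeGreen _).comp (f := fun s : ℝ => (s, r)) (by fun_prop)
      have hΦ' := hC (fun s => Φ s * freeGreen (2 * M + 3) s r) (hΦ.mul hGm)
        ⟨B * (G * greenMajorant M r), fun s hs => by
          rw [norm_mul]
          exact mul_le_mul (hB s hs) (hG s r hs hr.le) (norm_nonneg _)
            ((norm_nonneg _).trans (hB s hs))⟩
        (a * greenMajorant M r + b) (b * greenMajorant M r) (by positivity) (by positivity)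
        (fun rs hlen hrs => by
          have := h (r :: rs) (by simp [hlen]) (by
            intro r' hr'
            rcases List.mem_cons.1 hr' with rfl | hr'
            · exact hr
            · exact hrs r' hr')
          simp only [List.map_cons, greenProd_cons, one_mul, majorantProd_cons,
            majorantWeight] at this
          simp_rw [mul_assoc]
          refine this.trans (le_of_eq ?_)
          ring) x z hzx.symm
      have hfun : ∫ s, Φ s * compIntegrand V (bornKernel V s k) (freeResolvent s) x y z ∂μ
          = (V z : ℂ) * ∫ s, (Φ s * freeGreen (2 * M + 3) s r) * bornKernel V s k x z ∂μ := by
        rw [← integral_const_mul]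
        congr 1; ext s
        simp only [compIntegrand, freeResolvent, hrdef]
        ring
      rw [hfun, norm_mul, Complex.norm_real, Real.norm_eq_abs, norm_sub_rev z x]
      calc _ ≤ |V z| * _ := mul_le_mul_of_nonneg_left hΦ' (abs_nonneg _)
        _ = _ := by ring
    rw [hswap]
    refine (norm_integral_le_of_norm_le hdom hpt).trans ?_
    rw [integral_const_mul, mul_assoc C]
    refine mul_le_mul_of_nonneg_left ?_ hC0
    have i2 : Integrable fun z =>
        b * (|V z| * greenMajorant M ‖z - x‖) + b * (|V z| * greenMajorant M ‖z - y‖) :=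
      ((hS x).1.const_mul b).add ((hS y).1.const_mul b)
    rw [integral_add (hI.const_mul a) i2, integral_add ((hS x).1.const_mul b)
      ((hS y).1.const_mul b), integral_const_mul, integral_const_mul, integral_const_mul]
    have hKxy := greenMajorant_nonneg M (norm_nonneg (x - y))
    calc _ ≤ a * (T * greenMajorant M ‖x - y‖) + (b * S + b * S) := by
          gcongr
          exacts [(hS x).2, (hS y).2]
      _ ≤ _ := by
        have h1 : 0 ≤ T * b := by positivity
        have h2 : 0 ≤ S * (a * greenMajorant M ‖x - y‖) := by positivity
        nlinarith
end

lemma integral_symm_interval {L : ℝ} {f : ℝ → ℂ} (hf : IntervalIntegrable f volume (-L) 0)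
    (hf' : IntervalIntegrable f volume 0 L) :
    ∫ s in (-L)..L, f s = ∫ s in (0 : ℝ)..L, (f s + f (-s)) := by
  have h1 : IntervalIntegrable (fun s => f (-s)) volume 0 L := by
    simpa using ((IntervalIntegrable.iff_comp_neg enorm_ne_top).1 hf).symm
  rw [intervalIntegral.integral_add hf' h1, intervalIntegral.integral_comp_neg, neg_zero, add_comm,
    intervalIntegral.integral_add_adjacent_intervals hf hf']

theorem proposition4p1
    (n : ℕ) (hn : 5 ≤ n) (hodd : Odd n)
    (V : EuclideanSpace ℝ (Fin n) → ℝ) (hVmeas : Measurable V)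
    (A ε : ℝ) (hε : 0 < ε)
    (hV : ∀ x, |V x| ≤ A * (1 + ‖x‖) ^ (-(((n : ℝ) + 3) / 2 + ε)))
    (lam1 : ℝ) (hlam1 : 0 < lam1)
    (χ : ℝ → ℝ) (hχ : IsLowEnergyCutoff χ lam1)
    (m : ℕ) :
    -- off the diagonal the kernels of `R₀^±(VR₀^±)^k` are absolutely convergent integrals
    (∀ (k : ℕ) (lam : ℝ) (x y : EuclideanSpace ℝ (Fin n)), x ≠ y →
      Integrable (compIntegrand V (bornKernel V lam k) (freeResolvent lam) x y)) ∧
    -- the oscillatory integral converges and is `O(|t|^{-n/2})`, uniformly in `x` and `y`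
    (∃ C : ℝ, ∀ t : ℝ, t ≠ 0 → ∀ x y : EuclideanSpace ℝ (Fin n), x ≠ y →
      IntegrableOn (stoneIntegrand V χ m t x y) (Ioi 0) ∧
      ‖∫ lam in Ioi (0 : ℝ), stoneIntegrand V χ m t x y lam‖ ≤ C * |t| ^ (-((n : ℝ) / 2))) := by
  obtain ⟨M, rfl⟩ : ∃ M, n = 2 * M + 3 := by
    obtain ⟨j, rfl⟩ := hodd
    exact ⟨j - 1, by omega⟩
  have hV' : ∀ x, |V x| ≤ A * (1 + ‖x‖) ^ (-((M : ℝ) + 3 + ε)) := by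
    intro x
    convert hV x using 4
    push_cast; ring
  obtain ⟨S, hS⟩ := exists_potential_bound hVmeas hε hV'
  refine ⟨fun k lam x y hxy => integrable_compIntegrand hVmeas hS k lam hxy, ?_⟩
  have hη : IsAmplitude lam1 (fun s => (χ s : ℂ)) :=
    ⟨Complex.ofRealCLM.contDiff.comp hχ.smooth, fun s hs => by simp [hχ.eq_zero s hs]⟩
  have hχc : Continuous χ := hχ.smooth.continuous
  -- the integrand is extended to negative energies, where `λ χ(|λ|)` is odd
  set Φ : ℝ → ℝ → ℂ := fun t s =>
    Complex.exp (Complex.I * t * (s : ℂ) ^ 2) * ((s : ℂ) * (χ |s| : ℂ)) with hΦ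
  have hΦc : ∀ t, Continuous (Φ t) := fun t => by fun_prop
  have hΦneg : ∀ t s, Φ t (-s) = -Φ t s := fun t s => by simp [hΦ]
  obtain ⟨B, hB⟩ : ∃ B, ∀ t s, |s| ≤ lam1 → ‖Φ t s‖ ≤ B := by
    obtain ⟨B, hB⟩ := (isCompact_Icc (a := -lam1) (b := lam1)).exists_bound_of_continuousOn
      (hΦc 0).continuousOn
    refine ⟨B, fun t s hs => ?_⟩
    have := hB s (abs_le.1 hs)
    simp only [hΦ, norm_mul, norm_cexp_I_mul_mul_sq] at this ⊢
    exact this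
  set μ : Measure ℝ := volume.restrict (Ioc (-lam1) lam1) with hμdef
  have hμ : ∀ᵐ s ∂μ, |s| ≤ lam1 := by
    filter_upwards [ae_restrict_mem measurableSet_Ioc] with s hs
    exact abs_le.2 ⟨hs.1.le, hs.2⟩
  have hμint : ∀ f : ℝ → ℂ, ∫ s, f s ∂μ = ∫ s in (-lam1)..lam1, f s := fun f => by
    rw [intervalIntegral.integral_of_le (by linarith)]
  have hker : ∀ (t : ℝ) (k : ℕ) (x y : EuclideanSpace ℝ (Fin (2 * M + 3))), x ≠ y →
      Integrable (fun s => Φ t s * bornKernel V s k x y) μ := by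
    intro t k x y hxy
    obtain ⟨D, -, hD⟩ := exists_bornKernel_bound hVmeas hS lam1 k
    refine Integrable.of_bound ((hΦc t).measurable.mul
      (measurable_bornKernel_left hVmeas k x y)).aestronglyMeasurable
      (B * (D * greenMajorant M ‖x - y‖)) ?_
    filter_upwards [hμ] with s hs
    rw [norm_mul]
    exact mul_le_mul (hB t s hs) (hD s x y hs hxy) (norm_nonneg _)
      ((norm_nonneg _).trans (hB t s hs))
  have hsub1 : Ioc (-lam1) 0 ⊆ Ioc (-lam1) lam1 := Ioc_subset_Ioc_right hlam1.le
  have hsub2 : Ioc 0 lam1 ⊆ Ioc (-lam1) lam1 := Ioc_subset_Ioc_left (by linarith)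
  have hii1 : ∀ f : ℝ → ℂ, Integrable f μ → IntervalIntegrable f volume (-lam1) 0 := fun f hf =>
    (intervalIntegrable_iff_integrableOn_Ioc_of_le (by linarith)).2
      (IntegrableOn.mono_set hf hsub1)
  have hii2 : ∀ f : ℝ → ℂ, Integrable f μ → IntervalIntegrable f volume 0 lam1 := fun f hf =>
    (intervalIntegrable_iff_integrableOn_Ioc_of_le hlam1.le).2
      (IntegrableOn.mono_set hf hsub2)
  choose C₁ hC₁ using fun k => exists_greenProd_sub_bound hlam1 M k hη
  choose C₂ hC₂0 hC₂ using fun k => exists_born_integral_bound hVmeas hS hμ k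
  have hterm : ∀ (k : ℕ) (t : ℝ), t ≠ 0 → ∀ x y : EuclideanSpace ℝ (Fin (2 * M + 3)), x ≠ y →
      ‖∫ s, Φ t s * bornKernel V s k x y ∂μ‖
        ≤ C₂ k * (|C₁ k| * (|t| ^ (-(1 / 2) : ℝ) * |t|⁻¹ ^ (M + 1))) := by
    intro k t ht x y hxy
    have h := hC₂ k (Φ t) (hΦc t).measurable ⟨B, hB t⟩ 0
      (|C₁ k| * (|t| ^ (-(1 / 2) : ℝ) * |t|⁻¹ ^ (M + 1))) le_rfl (by positivity) ?_ x y hxy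
    · simpa using h
    intro rs hlen hrs
    have hgc := continuous_greenProd (2 * M + 3) (rs.map fun r => (1, r))
    have hfc : Continuous fun s => Φ t s * greenProd (2 * M + 3) (rs.map fun r => (1, r)) s :=
      (hΦc t).mul hgc
    have hgneg : ∀ s, greenProd (2 * M + 3) (rs.map fun r => (1, r)) (-s)
        = greenProd (2 * M + 3) (rs.map fun r => (-1, r)) s := fun s => by
      simp [greenProd, Function.comp_def]
    rw [hμint, integral_symm_interval (hfc.intervalIntegrable _ _) (hfc.intervalIntegrable _ _)]
    have heq : ∫ s in (0 : ℝ)..lam1, (Φ t s * greenProd (2 * M + 3) (rs.map fun r => (1, r)) s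
          + Φ t (-s) * greenProd (2 * M + 3) (rs.map fun r => (1, r)) (-s))
        = schrodingerIntegral lam1 t (fun s => s * (χ s : ℂ) *
        (greenProd (2 * M + 3) (rs.map fun r => (1, r)) s
          - greenProd (2 * M + 3) (rs.map fun r => (-1, r)) s)) := by
      unfold schrodingerIntegral
      refine intervalIntegral.integral_congr fun s hs => ?_
      rw [uIcc_of_le hlam1.le] at hs
      simp only [hΦneg, hgneg]
      simp only [hΦ, abs_of_nonneg hs.1]
      ring
    rw [heq]
    have hw := majorantWeight_nonneg M hrs
    refine (hC₁ k rs hlen hrs t ht).trans ?_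
    rw [zero_mul, zero_add]
    gcongr
    exact le_abs_self _
  refine ⟨∑ k ∈ Finset.range (2 * m + 2), C₂ k * |C₁ k|, fun t ht x y hxy => ?_⟩
  set g : ℕ → ℝ → ℂ := fun k s =>
    Φ t s * bornKernel V s k x y + Φ t (-s) * bornKernel V (-s) k x y with hg
  have hgi : ∀ k, IntervalIntegrable (g k) volume 0 lam1 := fun k => by
    have h1 := hii1 _ (hker t k x y hxy)
    have h2 := hii2 _ (hker t k x y hxy)
    have h3 : IntervalIntegrable (fun s => Φ t (-s) * bornKernel V (-s) k x y) volume 0 lam1 := by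
      simpa using ((IntervalIntegrable.iff_comp_neg enorm_ne_top).1 h1).symm
    exact h2.add h3
  have hgint : ∀ k, ∫ s in (0 : ℝ)..lam1, g k s = ∫ s, Φ t s * bornKernel V s k x y ∂μ := by
    intro k
    rw [hμint, integral_symm_interval (hii1 _ (hker t k x y hxy)) (hii2 _ (hker t k x y hxy))]
  have hstone : EqOn (stoneIntegrand V χ m t x y)
      (fun s => ∑ k ∈ Finset.range (2 * m + 2), (-1 : ℂ) ^ k * g k s) (Ioc 0 lam1) := by
    intro s hs
    simp only [stoneIntegrand, bornDifference, hg, hΦneg, Finset.mul_sum]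
    refine Finset.sum_congr rfl fun k _ => ?_
    simp only [hΦ, abs_of_pos hs.1]
    ring
  have hzero : ∀ s ∈ Ioi (0 : ℝ) \ Ioc 0 lam1, stoneIntegrand V χ m t x y s = 0 := by
    intro s hs
    have : lam1 < s := by
      by_contra hcon
      exact hs.2 ⟨hs.1, not_lt.1 hcon⟩
    simp [stoneIntegrand, hχ.eq_zero s this]
  have hsumint : IntervalIntegrable
      (fun s => ∑ k ∈ Finset.range (2 * m + 2), (-1 : ℂ) ^ k * g k s) volume 0 lam1 := by
    have := IntervalIntegrable.sum (Finset.range (2 * m + 2))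
      (f := fun k s => (-1 : ℂ) ^ k * g k s) fun k _ => (hgi k).const_mul _
    rwa [Finset.sum_fn] at this
  have hion : IntegrableOn (stoneIntegrand V χ m t x y) (Ioc 0 lam1) :=
    ((intervalIntegrable_iff_integrableOn_Ioc_of_le hlam1.le).1 hsumint).congr_fun
      hstone.symm measurableSet_Ioc
  refine ⟨hion.of_forall_sdiff_eq_zero measurableSet_Ioi hzero, ?_⟩
  rw [setIntegral_eq_of_subset_of_forall_sdiff_eq_zero measurableSet_Ioi Ioc_subset_Ioi_self hzero,
    setIntegral_congr_fun measurableSet_Ioc hstone, ← intervalIntegral.integral_of_le hlam1.le,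
    intervalIntegral.integral_finsetSum fun k _ => (hgi k).const_mul _]
  have hT : |t| ^ (-(1 / 2) : ℝ) * |t|⁻¹ ^ (M + 1) = |t| ^ (-(((2 * M + 3 : ℕ) : ℝ) / 2)) := by
    rw [inv_pow, ← Real.rpow_natCast, ← Real.rpow_neg (abs_nonneg t),
      ← Real.rpow_add (abs_pos.2 ht)]
    congr 1
    push_cast; ring
  rw [Finset.sum_mul]
  refine norm_sum_le_of_le _ fun k _ => ?_
  rw [intervalIntegral.integral_const_mul, hgint, norm_mul, norm_pow, norm_neg, norm_one, one_pow,
    one_mul, ← hT, mul_assoc]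
  exact hterm k t ht x y hxy
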